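/- For $c\in\mathbb R$ let $T_cf(x)=f(x-c)$ and $E_cf(x)=e^{2\pi i c x}f(x)$ on $L^2(\mathbb R)$. Let $\alpha>0$ and let $g:\mathbb R\to\mathbb C$ be continuous with $\operatorname{supp} g=[-\alpha,\alpha]$ and with only finitely many zeros in $[-\alpha,\alpha]$. Let $a,b>0$ satisfy $\alpha\le a<2\alpha$ and $\frac{M-1}{M}\le ab<\frac{M}{M+1}$ for some integer $M\ge 2$, and let $\kappa\in\{0,1,\dots,M-1\}$ be the largest integer with $(1-ab)\kappa\le b\alpha$. For $n\in\{1,\dots,\kappa\}$ define $$R_n(y)=\frac1{g(y)}\prod_{k=1}^{n-1}\frac{g\left(y+(1-ab)\frac kb-a\right)}{g\left(y+(1-ab)\frac kb\right)},\qquad L_n(y)=\frac1{g(y)}\prod_{k=1}^{n-1}\frac{g\left(y-(1-ab)\frac kb+a\right)}{g\left(y-(1-ab)\frac kb\right)},$$ where $R_n$ is defined at those points of $\left(a-\alpha,\ \alpha-(1-ab)\frac nb\right]$, and $L_n$ at those points of $\left[-\alpha+(1-ab)\frac nb,\ \alpha-a\right)$, at which no denominator vanishes. (Empty products are $1$; limits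 of $|R_n|$ and $|L_n|$ below are taken within these domains.) Then the Gabor system $\{E_{mb}T_{na}g\}_{m,n\in\mathbb Z}$ is a frame for $L^2(\mathbb R)$ if and only if the following four conditions hold: (i) $|g(x)|+|g(x+a)|>0$ for all $x\in[-a,0]$; (ii) whenever $n_+\in\{1,\dots,\kappa\}$ and $y_+\in\left(a-\alpha,\ \alpha-(1-ab)\frac{n_+}b\right]$ satisfy $g(y_+)=0$ and $\lim_{y\to y_+}|R_{n_+}(y)|=\infty$, then $g\left(y_++(1-ab)\frac{n_+}b-a\right)\ne0$; (iii) whenever $n_-\in\{1,\dots,\kappa\}$ and $y_-\in\left[-\alpha+(1-ab)\frac{n_-}b,\ \alpha-a\right)$ satisfy $g(y_-)=0$ and $\lim_{y\to y_-}|L_{n_-}(y)|=\infty$, then $g\left(y_--(1-ab)\frac{n_-}b+a\right)\ne0$; (iv) for all $n_+,y_+$ satisfying the hypotheses in (ii) and all $n_-,y_-$ satisfying the hypotheses in (iii), $\ y_++(1-ab)\frac{n_+}b\ne y_--(1-ab)\frac{n_-}b+a$. (If $\kappa=0$, conditions (ii)-(iv) hold vacuously.) Moreover, if the system is a frame, then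 there exists $h\in L^2(\mathbb R)$ with $\operatorname{supp}h\subseteq[-aM,aM]$ that is a dual window, i.e. $\{E_{mb}T_{na}h\}_{m,n\in\mathbb Z}$ is a frame and $$f=\sum_{m,n\in\mathbb Z}\langle f,E_{mb}T_{na}h\rangle\,E_{mb}T_{na}g\qquad\text{for all } f\in L^2(\mathbb R).$$ -/

import Mathlib

open Set Filter Topology MeasureTheory

noncomputable section

/-- A family `φ` in a Hilbert space is a frame: there are `A, B > 0` with
`A ‖f‖² ≤ ∑ |⟨f, φ i⟩|² ≤ B ‖f‖²` for every `f` (the sum being convergent). -/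
def IsFrame {ι H : Type*} [NormedAddCommGroup H] [InnerProductSpace ℂ H] (φ : ι → H) : Prop :=
  ∃ A B : ℝ, 0 < A ∧ 0 < B ∧ ∀ f : H,
    Summable (fun i => ‖inner ℂ (φ i) f‖ ^ 2) ∧
    A * ‖f‖ ^ 2 ≤ ∑' i, ‖inner ℂ (φ i) f‖ ^ 2 ∧
    ∑' i, ‖inner ℂ (φ i) f‖ ^ 2 ≤ B * ‖f‖ ^ 2

/-- `φ` and `ψ` are dual frames: both are frames and `f = ∑ ⟨f, ψ i⟩ φ i` for every `f`, with
unconditional convergence in norm (Mathlib's `inner` is linear in its second argument). -/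
def AreDualFrames {ι H : Type*} [NormedAddCommGroup H] [InnerProductSpace ℂ H]
    (φ ψ : ι → H) : Prop :=
  IsFrame φ ∧ IsFrame ψ ∧ ∀ f : H, HasSum (fun i => inner ℂ (ψ i) f • φ i) f

/-- The translation operator `T_c`. -/
def gaborTranslate (c : ℝ) (g : ℝ → ℂ) : ℝ → ℂ := fun x => g (x - c)

/-- The modulation operator `E_c`. -/
def gaborModulate (c : ℝ) (g : ℝ → ℂ) : ℝ → ℂ :=
  fun x => Complex.exp (2 * Real.pi * Complex.I * c * x) * g x

theorem memLp_gaborTranslate {g : ℝ → ℂ} (hg : MemLp g 2 volume) (c : ℝ) :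
    MemLp (gaborTranslate c g) 2 volume :=
  hg.comp_measurePreserving (measurePreserving_sub_right volume c)

theorem memLp_gaborModulate {g : ℝ → ℂ} (hg : MemLp g 2 volume) (c : ℝ) :
    MemLp (gaborModulate c g) 2 volume := by
  refine hg.of_le ?_ (Eventually.of_forall fun x => ?_)
  · have hc : Continuous fun x : ℝ => Complex.exp (2 * Real.pi * Complex.I * c * x) := by
      fun_prop
    exact hc.aestronglyMeasurable.mul hg.aestronglyMeasurable
  · have h : (2 * Real.pi * Complex.I * c * x : ℂ) = ((2 * Real.pi * c * x : ℝ) : ℂ) * Complex.I := by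
      push_cast; ring
    simp only [gaborModulate]
    rw [norm_mul, h, Complex.norm_exp_ofReal_mul_I, one_mul]

/-- The Gabor system `{E_{mb} T_{na} g}`, indexed by `(m, n) ∈ ℤ × ℤ`, in `L²(ℝ)`. -/
def gaborSystem {g : ℝ → ℂ} (hg : MemLp g 2 volume) (a b : ℝ) :
    ℤ × ℤ → Lp ℂ 2 (volume : Measure ℝ) :=
  fun p => (memLp_gaborModulate (memLp_gaborTranslate hg (p.2 * a)) (p.1 * b)).toLp

/-- The class `V_α` of continuous functions with (closed) support `[-α, α]` and only finitely
many zeros in `[-α, α]`. -/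
structure WindowClass (α : ℝ) (g : ℝ → ℂ) : Prop where
  continuous : Continuous g
  tsupport_eq : tsupport g = Icc (-α) α
  finite_zeros : {x ∈ Icc (-α) α | g x = 0}.Finite

theorem WindowClass.memLp {α : ℝ} {g : ℝ → ℂ} (hg : WindowClass α g) : MemLp g 2 volume :=
  hg.continuous.memLp_of_hasCompactSupport (by
    rw [HasCompactSupport, hg.tsupport_eq]; exact isCompact_Icc)

/-- The function `R_n`. -/
def Rfun (g : ℝ → ℂ) (a b : ℝ) (n : ℕ) (y : ℝ) : ℂ :=
  1 / g y * ∏ k ∈ Finset.Ico 1 n,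
    (g (y + (1 - a * b) * (k / b) - a) / g (y + (1 - a * b) * (k / b)))

/-- The function `L_n`. -/
def Lfun (g : ℝ → ℂ) (a b : ℝ) (n : ℕ) (y : ℝ) : ℂ :=
  1 / g y * ∏ k ∈ Finset.Ico 1 n,
    (g (y - (1 - a * b) * (k / b) + a) / g (y - (1 - a * b) * (k / b)))

/-- The interval `]a - α, α - (1 - ab) n / b]`. -/
def Rinterval (α a b : ℝ) (n : ℕ) : Set ℝ := Ioc (a - α) (α - (1 - a * b) * (n / b))

/-- The interval `[-α + (1 - ab) n / b, α - a[`. -/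
def Linterval (α a b : ℝ) (n : ℕ) : Set ℝ := Ico (-α + (1 - a * b) * (n / b)) (α - a)

/-- The domain of `R_n`: the points of its interval at which no denominator vanishes. -/
def Rdomain (g : ℝ → ℂ) (α a b : ℝ) (n : ℕ) : Set ℝ :=
  {y ∈ Rinterval α a b n | g y ≠ 0 ∧ ∀ k ∈ Finset.Ico 1 n, g (y + (1 - a * b) * (k / b)) ≠ 0}

/-- The domain of `L_n`: the points of its interval at which no denominator vanishes. -/
def Ldomain (g : ℝ → ℂ) (α a b : ℝ) (n : ℕ) : Set ℝ :=
  {y ∈ Linterval α a b n | g y ≠ 0 ∧ ∀ k ∈ Finset.Ico 1 n, g (y - (1 - a * b) * (k / b)) ≠ 0}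

/-- The pairs `(n₊, y₊)`: `n₊ ∈ {1, …, κ}`, `y₊` is a zero of `g` in the interval of `R_{n₊}`, and
`|R_{n₊}(y)| → ∞` as `y → y₊` within the domain of `R_{n₊}`. -/
def IsRPole (g : ℝ → ℂ) (α a b : ℝ) (κ n : ℕ) (y : ℝ) : Prop :=
  n ∈ Finset.Icc 1 κ ∧ y ∈ Rinterval α a b n ∧ g y = 0 ∧
    Tendsto (fun t => ‖Rfun g a b n t‖) (𝓝[Rdomain g α a b n] y) atTop

/-- The pairs `(n₋, y₋)`: `n₋ ∈ {1, …, κ}`, `y₋` is a zero of `g` in the interval of `L_{n₋}`, and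
`|L_{n₋}(y)| → ∞` as `y → y₋` within the domain of `L_{n₋}`. -/
def IsLPole (g : ℝ → ℂ) (α a b : ℝ) (κ n : ℕ) (y : ℝ) : Prop :=
  n ∈ Finset.Icc 1 κ ∧ y ∈ Linterval α a b n ∧ g y = 0 ∧
    Tendsto (fun t => ‖Lfun g a b n t‖) (𝓝[Ldomain g α a b n] y) atTop

end

/-! Put δ = 1/b - a. From ab < M/(M+1) one gets δ > 0 and a < Mδ. The proof passes through one
pointwise condition, `ChainCondition`: g has no zero y ≥ 0 for which g(y + nδ - a) = 0 as well, with
n ≥ 0 and y + nδ ≤ a. It is equivalent to the frame property and to (i)-(iv).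

Chain condition gives a dual window. By Parseval in m, duality of g and h reduces to the pointwise
relations ∑ₙ g(x - na) conj h(x + l/b - na) = b·[l = 0]. Fix t in [0, a) and let h_k stand for conj
h(t + ka)/b. Since g vanishes outside (-a, a), for sequences h_k that stop where described below the
relations collapse to the bidiagonal system g(t - lδ) h_l + g(t - lδ - a) h_{l-1} = [l = 0]. It can
be solved forwards from h_0 = 1/g(t), with h_k = 0 for k < 0, dividing by g(t - qδ) as long as qδ ≤
t; or backwards from h_{-1} = 1/g(t - a), with h_k = 0 for k ≥ 0, dividing by g(t + lδ - a) as long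
as t + lδ < a. If both directions met a zero, the two zeros would be the ends of a forbidden chain.
Compactness makes this quantitative, so h is bounded, and a < Mδ makes both recursions stop within M
steps, which places the support in [-aM, aM]. See `ChainCondition.exists_bound`,
`hasSum_mul_chainInverse` and `ChainCondition.exists_dual`.

A frame has the chain condition. A shortest forbidden chain from s yields a nonzero finite vector c
with ∑ⱼ cⱼ g(s + j/b - qa) = 0 for every q. Spreading conj c over small bumps around the points s +
j/b gives functions that violate the lower frame bound (`IsFrame.chainCondition`).

Chain condition and poles. Each of (i)-(iv) forbids particular chains, (iv) by joining two of them.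
Conversely (i) and (ii) already imply the chain condition, by induction on the length of the chain
(`chainCondition_of_poles`): the shorter chains show that the numerators of Rₙ do not vanish at y,
so a zero of g at y is a pole of Rₙ. -/

theorem hasSum_of_hasSum_of_eq {ι E : Type*} [AddCommMonoid E] [TopologicalSpace E] {f g : ι → E}
    {s t : E} (h : HasSum f s) (hf : ∀ i, g i = f i) (ht : t = s) : HasSum g t := by
  rw [ht, show g = f from funext hf]
  exact h

/-! ### Bessel families and duality in a Hilbert space. -/

section Hilbert

variable {ι H : Type*} [NormedAddCommGroup H] [InnerProductSpace ℂ H]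

/-- The synthesis operator of a Bessel family is bounded on finitely supported sequences. -/
theorem norm_sum_smul_sq_le_of_bessel {φ : ι → H} {B : ℝ} (hB : 0 ≤ B)
    (hφ : ∀ (f : H) (s : Finset ι), ∑ i ∈ s, ‖inner ℂ (φ i) f‖ ^ 2 ≤ B * ‖f‖ ^ 2)
    (c : ι → ℂ) (s : Finset ι) :
    ‖∑ i ∈ s, c i • φ i‖ ^ 2 ≤ B * ∑ i ∈ s, ‖c i‖ ^ 2 := by
  set v := ∑ i ∈ s, c i • φ i with hv
  -- Duality: pair v with itself and apply the Bessel bound to v.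
  have h1 : ‖v‖ ^ 2 ≤ ∑ i ∈ s, ‖c i‖ * ‖inner ℂ (φ i) v‖ := by
    have h2 : (inner ℂ v v : ℂ) = ∑ i ∈ s, c i * inner ℂ v (φ i) := by
      conv_lhs => rw [hv, ← hv, hv, inner_sum]
      simp only [inner_smul_right, ← hv]
    have h3 : ‖(inner ℂ v v : ℂ)‖ = ‖v‖ ^ 2 := by
      rw [inner_self_eq_norm_sq_to_K]; simp
    rw [← h3, h2]
    refine (norm_sum_le _ _).trans (Finset.sum_le_sum fun i _ => ?_)
    rw [norm_mul, norm_inner_symm]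
  have h4 : (∑ i ∈ s, ‖c i‖ * ‖inner ℂ (φ i) v‖) ^ 2
      ≤ (∑ i ∈ s, ‖c i‖ ^ 2) * ∑ i ∈ s, ‖inner ℂ (φ i) v‖ ^ 2 :=
    Finset.sum_mul_sq_le_sq_mul_sq _ _ _
  have h5 : (‖v‖ ^ 2) ^ 2 ≤ (∑ i ∈ s, ‖c i‖ ^ 2) * (B * ‖v‖ ^ 2) := by
    refine (pow_le_pow_left₀ (by positivity) h1 2).trans (h4.trans ?_)
    exact mul_le_mul_of_nonneg_left (hφ v s) (by positivity)
  rcases (norm_nonneg v).eq_or_lt with h0 | h0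
  · have h6 : 0 ≤ B * ∑ i ∈ s, ‖c i‖ ^ 2 :=
      mul_nonneg hB (Finset.sum_nonneg fun i _ => by positivity)
    simpa [← h0] using h6
  · nlinarith [pow_pos h0 2]

/-- Square-summable coefficients give an unconditionally convergent synthesis series. -/
theorem summable_smul_of_bessel [CompleteSpace H] {φ : ι → H} {B : ℝ} (hB : 0 < B)
    (hφ : ∀ (f : H) (s : Finset ι), ∑ i ∈ s, ‖inner ℂ (φ i) f‖ ^ 2 ≤ B * ‖f‖ ^ 2)
    {c : ι → ℂ} (hc : Summable fun i => ‖c i‖ ^ 2) : Summable fun i => c i • φ i := by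
  rw [summable_iff_vanishing_norm]
  intro ε hε
  obtain ⟨s, hs⟩ := summable_iff_vanishing_norm.1 hc (ε ^ 2 / B) (by positivity)
  refine ⟨s, fun t ht => ?_⟩
  have h1 := norm_sum_smul_sq_le_of_bessel hB.le hφ c t
  have h2 := (le_abs_self _).trans_lt (hs t ht)
  rw [lt_div_iff₀ hB] at h2
  exact lt_of_pow_lt_pow_left₀ 2 hε.le (by nlinarith)

/-- A Bessel family with a dual Bessel family (in the weak sense) is a frame. -/
theorem isFrame_of_bessel_of_hasSum {φ ψ : ι → H} {B : ℝ} (hB : 0 < B)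
    (hφ : ∀ (f : H) (s : Finset ι), ∑ i ∈ s, ‖inner ℂ (φ i) f‖ ^ 2 ≤ B * ‖f‖ ^ 2)
    (hψ : ∀ (f : H) (s : Finset ι), ∑ i ∈ s, ‖inner ℂ (ψ i) f‖ ^ 2 ≤ B * ‖f‖ ^ 2)
    (hd : ∀ f : H, HasSum (fun i => inner ℂ f (φ i) * inner ℂ (ψ i) f) (inner ℂ f f)) :
    IsFrame φ := by
  have hs : ∀ f, Summable fun i => ‖inner ℂ (φ i) f‖ ^ 2 := fun f =>
    summable_of_sum_le (fun i => by positivity) (hφ f)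
  refine ⟨B⁻¹, B, by positivity, hB, fun f => ⟨hs f, ?_,
    (hs f).tsum_le_of_sum_le (hφ f)⟩⟩
  set S := ∑' i, ‖inner ℂ (φ i) f‖ ^ 2 with hS
  have hS0 : 0 ≤ S := tsum_nonneg fun i => by positivity
  -- Cauchy–Schwarz in the reconstruction of ⟨f, f⟩ gives ‖f‖⁴ ≤ S · B‖f‖², hence the lower frame
  -- bound 1/B.
  have h1 : ‖(inner ℂ f f : ℂ)‖ ≤ √(S * (B * ‖f‖ ^ 2)) := by
    refine le_of_tendsto (hd f).norm (Eventually.of_forall fun s => ?_)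
    refine Real.le_sqrt_of_sq_le ?_
    have h2 : ‖∑ i ∈ s, inner ℂ f (φ i) * inner ℂ (ψ i) f‖
        ≤ ∑ i ∈ s, ‖inner ℂ (φ i) f‖ * ‖inner ℂ (ψ i) f‖ := by
      refine (norm_sum_le _ _).trans (Finset.sum_le_sum fun i _ => ?_)
      rw [norm_mul, norm_inner_symm]
    refine (pow_le_pow_left₀ (norm_nonneg _) h2 2).trans
      ((Finset.sum_mul_sq_le_sq_mul_sq _ _ _).trans ?_)
    exact mul_le_mul ((hs f).sum_le_tsum s fun i _ => by positivity) (hψ f s) (by positivity) hS0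
  have h3 : ‖(inner ℂ f f : ℂ)‖ = ‖f‖ ^ 2 := by
    rw [inner_self_eq_norm_sq_to_K]; simp
  rw [h3] at h1
  rw [inv_mul_le_iff₀ hB]
  rcases (norm_nonneg f).eq_or_lt with h0 | h0
  · rw [← h0]
    simpa using mul_nonneg hB.le hS0
  · have h5 : 0 < ‖f‖ ^ 2 := pow_pos h0 2
    have h4 := (Real.le_sqrt' h5).1 h1
    nlinarith

/-- Two Bessel families that are dual to each other in the weak sense are dual frames. -/
theorem areDualFrames_of_bessel_of_hasSum [CompleteSpace H] {φ ψ : ι → H} {B : ℝ} (hB : 0 < B)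
    (hφ : ∀ (f : H) (s : Finset ι), ∑ i ∈ s, ‖inner ℂ (φ i) f‖ ^ 2 ≤ B * ‖f‖ ^ 2)
    (hψ : ∀ (f : H) (s : Finset ι), ∑ i ∈ s, ‖inner ℂ (ψ i) f‖ ^ 2 ≤ B * ‖f‖ ^ 2)
    (hd : ∀ f' f : H, HasSum (fun i => inner ℂ f' (φ i) * inner ℂ (ψ i) f) (inner ℂ f' f)) :
    AreDualFrames φ ψ := by
  refine ⟨isFrame_of_bessel_of_hasSum hB hφ hψ fun f => hd f f,
    isFrame_of_bessel_of_hasSum hB hψ hφ fun f => ?_, fun f => ?_⟩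
  · have h := (hd f f).star
    simpa [mul_comm] using h
  · have hs : Summable fun i => inner ℂ (ψ i) f • φ i :=
      summable_smul_of_bessel hB hφ (summable_of_sum_le (fun i => by positivity) (hψ f))
    convert hs.hasSum using 1
    refine ext_inner_left ℂ fun f' => ?_
    have h1 := hs.hasSum.mapL (innerSL ℂ f')
    refine (hd f' f).unique ?_
    simpa [inner_smul_right, mul_comm] using h1

end Hilbert

/-! ### Fourier samples and periodization. -/

section Periodization

open scoped ComplexConjugate

/-- Parseval's identity for the inner product of two functions on an interval. -/
theorem hasSum_conj_fourierCoeffOn_mul {a b : ℝ} {f g : ℝ → ℂ} (hab : a < b)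
    (hf : MemLp f 2 (volume.restrict (Ioc a b))) (hg : MemLp g 2 (volume.restrict (Ioc a b))) :
    HasSum (fun i => conj (fourierCoeffOn hab f i) * fourierCoeffOn hab g i)
      ((b - a)⁻¹ • ∫ x in a..b, conj (f x) * g x) := by
  have := Fact.mk (by linarith : 0 < b - a)
  rw [← add_sub_cancel a b] at hf hg
  have h := hf.memLp_liftIoc.haarAddCircle
  have h' := hg.memLp_liftIoc.haarAddCircle
  refine hasSum_of_hasSum_of_eq
    ((fourierBasis (T := b - a)).hasSum_inner_mul_inner h.toLp h'.toLp) (fun i => ?_) ?_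
  · rw [← inner_conj_symm, ← HilbertBasis.repr_apply_apply, ← HilbertBasis.repr_apply_apply,
      fourierBasis_repr, fourierBasis_repr]
    simp [fourierCoeff_congr_ae h.coeFn_toLp, fourierCoeff_congr_ae h'.coeFn_toLp,
      fourierCoeff_liftIoc_eq]
  · rw [MeasureTheory.L2.inner_def]
    have h1 : (fun x => inner ℂ (h.toLp _ x) (h'.toLp _ x)) =ᵐ[AddCircle.haarAddCircle]
        AddCircle.liftIoc (b - a) a (fun x => conj (f x) * g x) := by
      filter_upwards [h.coeFn_toLp, h'.coeFn_toLp] with x hx hx'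
      rw [hx, hx', RCLike.inner_apply, mul_comm]
      rfl
    rw [integral_congr_ae h1, AddCircle.integral_haarAddCircle,
      AddCircle.integral_liftIoc_eq_intervalIntegral, add_sub_cancel]

/-- The periodization, on one period, of a function supported on `N` periods. -/
noncomputable def periodize (T : ℝ) (N : ℕ) (F : ℝ → ℂ) (x : ℝ) : ℂ := ∑ k ∈ Finset.range N, F (x + k * T)

/-- The Fourier transform of `F` at `m b`. -/
noncomputable def expCoeff (b : ℝ) (F : ℝ → ℂ) (m : ℤ) : ℂ :=
  ∫ x : ℝ, Complex.exp (-(2 * Real.pi * Complex.I * (m * b) * x)) * F x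

theorem integral_eq_integral_sum_translates {E : Type*} [NormedAddCommGroup E] [NormedSpace ℝ E]
    {T u : ℝ} (hT : 0 < T) {N : ℕ} {F : ℝ → E}
    (hF : Integrable F) (hsupp : ∀ x, x ∉ Ioc u (u + N * T) → F x = 0) :
    ∫ x, F x = ∫ x in u..u + T, ∑ k ∈ Finset.range N, F (x + k * T) := by
  have h1 : ∫ x, F x = ∫ x in u..u + N * T, F x := by
    rw [intervalIntegral.integral_of_le (by nlinarith [mul_nonneg N.cast_nonneg hT.le]),
      setIntegral_eq_integral_of_forall_compl_eq_zero hsupp]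
  have h2 := intervalIntegral.sum_integral_adjacent_intervals (μ := volume) (f := F)
    (a := fun k : ℕ => u + k * T) (n := N) fun k _ => hF.intervalIntegrable
  simp only [Nat.cast_zero, zero_mul, add_zero] at h2
  rw [h1, ← h2, intervalIntegral.integral_finsetSum
    fun k _ => (hF.comp_add_right _).intervalIntegrable]
  refine Finset.sum_congr rfl fun k _ => ?_
  rw [intervalIntegral.integral_comp_add_right]
  congr 1
  push_cast; ring

theorem memLp_periodize {T : ℝ} {N : ℕ} {F : ℝ → ℂ} (hF : MemLp F 2 volume) :
    MemLp (periodize T N F) 2 volume :=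
  memLp_finsetSum _ fun _ _ => hF.comp_measurePreserving (measurePreserving_add_right volume _)

/-- The exponential of frequency mb has period T = 1/b, so the integral over the line folds onto one
period. -/
theorem expCoeff_eq_fourierCoeffOn {T b u : ℝ} (hT : 0 < T) (hb : b * T = 1) {N : ℕ} {F : ℝ → ℂ}
    (hF : Integrable F) (hsupp : ∀ x, x ∉ Ioc u (u + N * T) → F x = 0) (m : ℤ) :
    expCoeff b F m = T * fourierCoeffOn (lt_add_of_pos_right u hT) (periodize T N F) m := by
  have hT0 : (T : ℂ) ≠ 0 := by exact_mod_cast hT.ne'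
  have hbT : (b : ℂ) = 1 / T := by
    rw [eq_div_iff hT0]; exact_mod_cast hb
  rw [fourierCoeffOn_eq_integral, expCoeff, integral_eq_integral_sum_translates hT (N := N) (u := u)]
  · rw [add_sub_cancel_left, Complex.real_smul]
    push_cast
    rw [← mul_assoc (T : ℂ) (1 / T), mul_one_div_cancel hT0, one_mul]
    refine intervalIntegral.integral_congr fun x _ => ?_
    simp only [periodize, fourier_coe_apply, smul_eq_mul, Finset.mul_sum]
    refine Finset.sum_congr rfl fun k _ => ?_
    congr 1
    rw [Complex.exp_eq_exp_iff_exists_int]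
    refine ⟨-(m * k), ?_⟩
    rw [hbT]
    push_cast
    field_simp
    ring
  · refine hF.bdd_mul (c := 1) ?_ ?_
    · exact (by fun_prop : Continuous fun x : ℝ =>
        Complex.exp (-(2 * Real.pi * Complex.I * (m * b) * x))).aestronglyMeasurable
    · refine Eventually.of_forall fun x => ?_
      have h : (-(2 * Real.pi * Complex.I * (m * b) * x) : ℂ)
          = ((-(2 * Real.pi * (m * b) * x) : ℝ) : ℂ) * Complex.I := by
        push_cast; ring
      rw [h, Complex.norm_exp_ofReal_mul_I]
  · intro x hx
    simp [hsupp x hx]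

theorem integrable_of_memLp_two_of_support {F : ℝ → ℂ} (hF : MemLp F 2 volume) {u v : ℝ}
    (hsupp : ∀ x, x ∉ Ioc u v → F x = 0) : Integrable F := by
  have h1 : IntegrableOn F (Ioc u v) :=
    (hF.restrict _).integrable (by norm_num)
  exact (integrableOn_iff_integrable_of_support_subset fun x hx => by
    by_contra h; exact hx (hsupp x h)).1 h1

/-- The squared Fourier samples of `F` sum to the squared norm of its periodization. -/
theorem hasSum_norm_sq_expCoeff {T b u : ℝ} (hT : 0 < T) (hb : b * T = 1) {N : ℕ} {F : ℝ → ℂ}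
    (hF : MemLp F 2 volume) (hsupp : ∀ x, x ∉ Ioc u (u + N * T) → F x = 0) :
    HasSum (fun m : ℤ => ‖expCoeff b F m‖ ^ 2)
      (T * ∫ x in u..u + T, ‖periodize T N F x‖ ^ 2) := by
  have hi := integrable_of_memLp_two_of_support hF hsupp
  have h := (hasSum_sq_fourierCoeffOn (lt_add_of_pos_right u hT)
    ((memLp_periodize (T := T) (N := N) hF).restrict (Ioc u (u + T)))).mul_left (T ^ 2)
  refine hasSum_of_hasSum_of_eq h (fun m => ?_) ?_
  · rw [expCoeff_eq_fourierCoeffOn hT hb hi hsupp, norm_mul, mul_pow]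
    simp
  · rw [add_sub_cancel_left, smul_eq_mul]
    field_simp

/-- Cauchy–Schwarz on the N summands of the periodization, followed by unfolding. -/
theorem integral_norm_periodize_sq_le {T u : ℝ} (hT : 0 < T) {N : ℕ} {F : ℝ → ℂ}
    (hF : MemLp F 2 volume) (hsupp : ∀ x, x ∉ Ioc u (u + N * T) → F x = 0) :
    ∫ x in u..u + T, ‖periodize T N F x‖ ^ 2 ≤ N * ∫ x, ‖F x‖ ^ 2 := by
  have hi : Integrable fun x => ‖F x‖ ^ 2 := hF.integrable_norm_pow (by norm_num)
  rw [integral_eq_integral_sum_translates hT hi fun x hx => by simp [hsupp x hx],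
    ← intervalIntegral.integral_const_mul]
  refine intervalIntegral.integral_mono_on (by linarith)
    ((memLp_periodize hF).integrable_norm_pow (by norm_num)).intervalIntegrable
    ((integrable_finsetSum _ fun k _ => hi.comp_add_right _).const_mul _).intervalIntegrable
    fun x _ => ?_
  refine (pow_le_pow_left₀ (norm_nonneg _) (norm_sum_le _ _) 2).trans ?_
  simpa using sq_sum_le_card_mul_sum_sq (s := Finset.range N) (f := fun k => ‖F (x + k * T)‖)

/-- The inner product of the Fourier samples of `F` and `G`, as an integral over the line. -/
theorem hasSum_conj_expCoeff_mul {T b u : ℝ} (hT : 0 < T) (hb : b * T = 1) {N : ℕ} {F G : ℝ → ℂ}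
    (hF : MemLp F 2 volume) (hsuppF : ∀ x, x ∉ Ioc u (u + N * T) → F x = 0)
    (hG : MemLp G 2 volume) (hsuppG : ∀ x, x ∉ Ioc u (u + N * T) → G x = 0) :
    HasSum (fun m : ℤ => conj (expCoeff b F m) * expCoeff b G m)
      (T * ∑ l ∈ Finset.Icc (-N : ℤ) N, ∫ x, conj (F x) * G (x + l * T)) := by
  have hiF := integrable_of_memLp_two_of_support hF hsuppF
  have hiG := integrable_of_memLp_two_of_support hG hsuppG
  have h := (hasSum_conj_fourierCoeffOn_mul (lt_add_of_pos_right u hT)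
    ((memLp_periodize (T := T) (N := N) hF).restrict (Ioc u (u + T)))
    ((memLp_periodize (T := T) (N := N) hG).restrict (Ioc u (u + T)))).mul_left ((T : ℂ) ^ 2)
  have hcF : MemLp (fun x => conj (F x)) 2 volume := hF.star
  have hint : ∀ l : ℤ, Integrable fun x => conj (F x) * G (x + l * T) := fun l =>
    hcF.integrable_mul (hG.comp_measurePreserving (measurePreserving_add_right volume _))
  refine hasSum_of_hasSum_of_eq h (fun m => ?_) ?_
  · rw [expCoeff_eq_fourierCoeffOn hT hb hiF hsuppF, expCoeff_eq_fourierCoeffOn hT hb hiG hsuppG,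
      map_mul, Complex.conj_ofReal]
    ring
  · have hT0 : (T : ℂ) ≠ 0 := by exact_mod_cast hT.ne'
    rw [add_sub_cancel_left, Complex.real_smul, ← integral_finsetSum _ fun l _ => hint l,
      integral_eq_integral_sum_translates hT (integrable_finsetSum _ fun l _ => hint l)
        (N := N) (u := u) fun x hx => by simp [hsuppF x hx]]
    push_cast
    rw [← mul_assoc, pow_two, mul_assoc (T : ℂ), mul_inv_cancel₀ hT0, mul_one]
    congr 1
    refine intervalIntegral.integral_congr_ae (Eventually.of_forall fun x hx => ?_)
    rw [uIoc_of_le (by linarith)] at hx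
    simp only [periodize, map_sum, Finset.sum_mul]
    refine Finset.sum_congr rfl fun k hk => ?_
    rw [← Finset.mul_sum]
    congr 1
    symm
    have hkN := Finset.mem_range.1 hk
    -- With j and k numbering periods, l = j - k. Since x lies in the first period, a nonzero term
    -- G(x + (k + l)T) forces 0 ≤ k + l < N, so the range [-N, N] for l misses nothing.
    refine Finset.sum_bij_ne_zero (fun j _ _ => (j : ℤ) - k) ?_ ?_ ?_ ?_
    · intro j hj _
      have := Finset.mem_range.1 hj
      rw [Finset.mem_Icc]; omega
    · intro j _ _ j' _ _ hjj; omega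
    · intro l _ hl
      have h1 : x + k * T + l * T ∈ Ioc u (u + N * T) := by
        by_contra hc; exact hl (hsuppG _ hc)
      have h2 : (0 : ℝ) < ((k + l + 1 : ℤ) : ℝ) := by
        push_cast
        have := h1.1
        have := hx.2
        by_contra hc
        nlinarith
      have h3 : ((k + l : ℤ) : ℝ) < (N : ℤ) := by
        push_cast
        have := h1.2
        have := hx.1
        by_contra hc
        nlinarith
      have h2' : 0 < (k : ℤ) + l + 1 := by exact_mod_cast h2
      have h3' : (k : ℤ) + l < N := by exact_mod_cast h3
      obtain ⟨j, hj⟩ := Int.eq_ofNat_of_zero_le (show 0 ≤ (k : ℤ) + l by omega)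
      have hjl : l = (j : ℤ) - k := by omega
      refine ⟨j, Finset.mem_range.2 (by omega), ?_, hjl.symm⟩
      convert hl using 2
      rw [hjl]; push_cast; ring
    · intro j _ _
      congr 1
      push_cast; ring

end Periodization

/-! ### Bessel bounds and the pointwise duality criterion for Gabor systems. -/

section GaborSystems

open scoped ComplexConjugate

theorem norm_sq_eq_integral_norm_sq (f : Lp ℂ 2 (volume : Measure ℝ)) :
    ‖f‖ ^ 2 = ∫ x, ‖f x‖ ^ 2 := by
  have h1 : ((‖f‖ ^ 2 : ℝ) : ℂ) = ((∫ x, ‖f x‖ ^ 2 : ℝ) : ℂ) := by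
    have h2 : (inner ℂ f f : ℂ) = ((‖f‖ ^ 2 : ℝ) : ℂ) := by
      rw [inner_self_eq_norm_sq_to_K]; simp
    rw [← h2, MeasureTheory.L2.inner_def, ← integral_complex_ofReal]
    refine integral_congr_ae (Eventually.of_forall fun x => ?_)
    simp only
    rw [inner_self_eq_norm_sq_to_K]; simp
  exact_mod_cast h1

theorem inner_gaborSystem {g : ℝ → ℂ} (hg : MemLp g 2 volume) (a b : ℝ) (m n : ℤ)
    (f : Lp ℂ 2 (volume : Measure ℝ)) :
    inner ℂ (gaborSystem hg a b (m, n)) f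
      = expCoeff b (fun x => conj (g (x - n * a)) * f x) m := by
  rw [MeasureTheory.L2.inner_def, expCoeff]
  refine integral_congr_ae ?_
  filter_upwards [(memLp_gaborModulate (memLp_gaborTranslate hg (n * a)) (m * b)).coeFn_toLp]
    with x hx
  simp only [gaborSystem]
  rw [hx, RCLike.inner_apply, gaborModulate, gaborTranslate, map_mul, ← Complex.exp_conj]
  simp only [map_mul, Complex.conj_I, Complex.conj_ofReal, map_ofNat]
  rw [mul_comm, mul_assoc]
  congr 2
  push_cast
  ring

theorem inner_gaborSystem_toLp {g f : ℝ → ℂ} (hg : MemLp g 2 volume) (hf : MemLp f 2 volume)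
    (a b : ℝ) (m n : ℤ) : inner ℂ (gaborSystem hg a b (m, n)) hf.toLp
      = expCoeff b (fun x => conj (g (x - n * a)) * f x) m := by
  rw [inner_gaborSystem]
  refine integral_congr_ae ?_
  filter_upwards [hf.coeFn_toLp] with x hx
  rw [hx]

theorem exists_card_filter_abs_lt_le {a : ℝ} (ha : 0 < a) (ρ : ℝ) :
    ∃ K : ℕ, ∀ (x : ℝ) (S : Finset ℤ), (S.filter fun n : ℤ => |x - n * a| < ρ).card ≤ K := by
  refine ⟨⌊2 * ρ / a + 1⌋₊, fun x S => ?_⟩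
  have h1 : (S.filter fun n : ℤ => |x - n * a| < ρ) ⊆
      Finset.Icc ⌈(x - ρ) / a⌉ ⌊(x + ρ) / a⌋ := by
    intro n hn
    have h2 := abs_lt.1 (Finset.mem_filter.1 hn).2
    rw [Finset.mem_Icc, Int.ceil_le, Int.le_floor, div_le_iff₀ ha, le_div_iff₀ ha]
    constructor <;> linarith
  refine (Finset.card_le_card h1).trans ?_
  rw [Int.card_Icc]
  by_cases h0 : ⌊(x + ρ) / a⌋ + 1 - ⌈(x - ρ) / a⌉ ≤ 0
  · rw [Int.toNat_of_nonpos h0]; exact Nat.zero_le _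
  · refine Nat.le_floor ?_
    have h2 : (((⌊(x + ρ) / a⌋ + 1 - ⌈(x - ρ) / a⌉).toNat : ℤ) : ℝ)
        = ⌊(x + ρ) / a⌋ + 1 - ⌈(x - ρ) / a⌉ := by
      rw [Int.toNat_of_nonneg (by omega)]; push_cast; ring
    have h3 := Int.floor_le ((x + ρ) / a)
    have h4 := Int.le_ceil ((x - ρ) / a)
    have h5 : (x + ρ) / a - (x - ρ) / a = 2 * ρ / a := by ring
    rw [Int.cast_natCast] at h2
    rw [h2]
    linarith

/-- Translates of a bounded compactly supported function overlap boundedly. -/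
theorem exists_sum_translates_le {a : ℝ} (ha : 0 < a) (ρ C : ℝ) (hC : 0 ≤ C) :
    ∃ K : ℝ, 0 < K ∧ ∀ w : ℝ → ℝ, (∀ x, w x ≤ C) → (∀ x, ρ ≤ |x| → w x = 0) →
      ∀ (x : ℝ) (S : Finset ℤ), ∑ n ∈ S, w (x - n * a) ≤ K := by
  obtain ⟨K, hK⟩ := exists_card_filter_abs_lt_le ha ρ
  refine ⟨K * C + 1, by positivity, fun w hw hρ x S => ?_⟩
  rw [← Finset.sum_filter_of_ne (p := fun n : ℤ => |x - n * a| < ρ)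
    fun n _ hn => not_le.1 fun hc => hn (hρ _ hc)]
  refine (Finset.sum_le_card_nsmul _ _ C fun n _ => hw _).trans ?_
  rw [nsmul_eq_mul]
  have : ((S.filter fun n : ℤ => |x - n * a| < ρ).card : ℝ) ≤ K := by exact_mod_cast hK x S
  nlinarith

/-- A square-integrable window bounded by `C` and vanishing outside `(-ρ, ρ)`. -/
structure IsCompactWindow (g : ℝ → ℂ) (ρ C : ℝ) : Prop where
  memLp : MemLp g 2 volume
  norm_le : ∀ x, ‖g x‖ ≤ C
  eq_zero : ∀ x, ρ ≤ |x| → g x = 0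

namespace IsCompactWindow

variable {g h : ℝ → ℂ} {ρ C : ℝ}

theorem memLp_conj_translate_mul (hg : IsCompactWindow g ρ C) (c : ℝ)
    {f : ℝ → ℂ} (hf : MemLp f 2 volume) :
    MemLp (fun x => conj (g (x - c)) * f x) 2 volume := by
  have h1 : AEStronglyMeasurable (fun x => conj (g (x - c))) volume :=
    (memLp_gaborTranslate hg.memLp c).star.aestronglyMeasurable
  refine hf.of_le_mul (c := C) (h1.mul hf.aestronglyMeasurable) (Eventually.of_forall fun x => ?_)
  rw [norm_mul, RCLike.norm_conj]
  exact mul_le_mul_of_nonneg_right (hg.norm_le _) (norm_nonneg _)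

theorem conj_translate_mul_eq_zero (hg : IsCompactWindow g ρ C) {T : ℝ} {N : ℕ}
    (hN : 2 * ρ ≤ N * T) (c : ℝ) (f : ℝ → ℂ) (x : ℝ)
    (hx : x ∉ Ioc (c - ρ) (c - ρ + N * T)) : conj (g (x - c)) * f x = 0 := by
  rw [hg.eq_zero, map_zero, zero_mul]
  by_contra hc
  rw [not_le, abs_lt] at hc
  exact hx ⟨by linarith, by linarith⟩

/-- For fixed n the sum over m is the squared norm of a periodization, at most a multiple of ∫ |g(x
- na)|²|f|²; the sum over n is controlled by the bounded overlap of the translates. The bound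
depends only on a, b, ρ, C, so a window and its dual can share it. -/
theorem exists_bessel_bound {a b : ℝ} (ha : 0 < a) (hb : 0 < b) (ρ C : ℝ) :
    ∃ B : ℝ, 0 < B ∧ ∀ (g : ℝ → ℂ) (hg : IsCompactWindow g ρ C)
      (f : Lp ℂ 2 (volume : Measure ℝ)) (s : Finset (ℤ × ℤ)),
      ∑ i ∈ s, ‖inner ℂ (gaborSystem hg.memLp a b i) f‖ ^ 2 ≤ B * ‖f‖ ^ 2 := by
  obtain ⟨K, hK, hw⟩ := exists_sum_translates_le ha ρ (C ^ 2) (by positivity)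
  have hT : 0 < 1 / b := by positivity
  obtain ⟨N, hN⟩ := exists_nat_ge (2 * ρ / (1 / b) + 1)
  have hN' : 2 * ρ ≤ N * (1 / b) := by
    rw [← div_le_iff₀ hT]; linarith
  refine ⟨1 / b * (N * K) + 1, by positivity, fun g hg f s => ?_⟩
  have hf2 : Integrable fun x => ‖f x‖ ^ 2 := (Lp.memLp f).integrable_norm_pow (by norm_num)
  have hn : ∀ (n : ℤ) (S : Finset ℤ),
      ∑ m ∈ S, ‖inner ℂ (gaborSystem hg.memLp a b (m, n)) f‖ ^ 2
        ≤ 1 / b * (N * ∫ x, ‖g (x - n * a)‖ ^ 2 * ‖f x‖ ^ 2) := by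
    intro n S
    have hF := hg.memLp_conj_translate_mul (n * a) (Lp.memLp f)
    have hs := hg.conj_translate_mul_eq_zero hN' (n * a) f
    have h1 := hasSum_norm_sq_expCoeff hT (mul_one_div_cancel hb.ne') hF hs
    simp only [inner_gaborSystem]
    refine (sum_le_hasSum S (fun _ _ => by positivity) h1).trans ?_
    refine mul_le_mul_of_nonneg_left ((integral_norm_periodize_sq_le hT hF hs).trans_eq ?_) hT.le
    simp only [norm_mul, RCLike.norm_conj, mul_pow]
  have hint : ∀ n : ℤ, Integrable fun x => ‖g (x - n * a)‖ ^ 2 * ‖f x‖ ^ 2 := by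
    intro n
    have := (hg.memLp_conj_translate_mul (n * a) (Lp.memLp f)).integrable_norm_pow (by norm_num)
    simpa only [norm_mul, RCLike.norm_conj, mul_pow] using this
  calc ∑ i ∈ s, ‖inner ℂ (gaborSystem hg.memLp a b i) f‖ ^ 2
      ≤ ∑ i ∈ s.image Prod.fst ×ˢ s.image Prod.snd,
          ‖inner ℂ (gaborSystem hg.memLp a b i) f‖ ^ 2 :=
        Finset.sum_le_sum_of_subset_of_nonneg Finset.subset_product fun _ _ _ => by positivity
    _ = ∑ n ∈ s.image Prod.snd, ∑ m ∈ s.image Prod.fst,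
          ‖inner ℂ (gaborSystem hg.memLp a b (m, n)) f‖ ^ 2 := Finset.sum_product_right _ _ _
    _ ≤ ∑ n ∈ s.image Prod.snd, 1 / b * (N * ∫ x, ‖g (x - n * a)‖ ^ 2 * ‖f x‖ ^ 2) :=
        Finset.sum_le_sum fun n _ => hn n _
    _ = 1 / b * (N * ∫ x, ∑ n ∈ s.image Prod.snd, ‖g (x - n * a)‖ ^ 2 * ‖f x‖ ^ 2) := by
        rw [← Finset.mul_sum, ← Finset.mul_sum, integral_finsetSum _ fun n _ => hint n]
    _ ≤ 1 / b * (N * ∫ x, K * ‖f x‖ ^ 2) := by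
        gcongr with x
        · exact integrable_finsetSum _ fun n _ => hint n
        · exact hf2.const_mul _
        · intro x
          simp only
          rw [← Finset.sum_mul]
          refine mul_le_mul_of_nonneg_right (hw (fun x => ‖g x‖ ^ 2) (fun x => ?_) (fun x hx => ?_)
            x _) (by positivity)
          · exact pow_le_pow_left₀ (norm_nonneg _) (hg.norm_le x) 2
          · simp [hg.eq_zero x hx]
    _ ≤ (1 / b * (N * K) + 1) * ‖f‖ ^ 2 := by
        rw [integral_const_mul, ← norm_sq_eq_integral_norm_sq]
        nlinarith [sq_nonneg ‖f‖]

/-- Two compact windows satisfying the pointwise duality relations generate weakly dual systems. -/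
theorem hasSum_inner_mul_inner_of_duality (hg : IsCompactWindow g ρ C) (hh : IsCompactWindow h ρ C)
    {a b : ℝ} (ha : 0 < a) (hb : 0 < b)
    (hd : ∀ (x : ℝ) (l : ℤ), HasSum (fun n : ℤ => g (x - n * a) * conj (h (x + l * (1 / b) - n * a)))
      (if l = 0 then (b : ℂ) else 0)) (f' f : Lp ℂ 2 (volume : Measure ℝ)) :
    HasSum (fun i => inner ℂ f' (gaborSystem hg.memLp a b i) *
      inner ℂ (gaborSystem hh.memLp a b i) f) (inner ℂ f' f) := by
  have hT : 0 < 1 / b := by positivity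
  have hC : 0 ≤ C := (norm_nonneg _).trans (hg.norm_le 0)
  have hbc : (b : ℂ) ≠ 0 := by exact_mod_cast hb.ne'
  obtain ⟨N, hN⟩ := exists_nat_ge (2 * ρ / (1 / b) + 1)
  have hN' : 2 * ρ ≤ N * (1 / b) := by
    rw [← div_le_iff₀ hT]; linarith
  obtain ⟨B, hB, hbes⟩ := exists_bessel_bound ha hb ρ C
  have hsum : Summable fun i => inner ℂ f' (gaborSystem hg.memLp a b i) *
      inner ℂ (gaborSystem hh.memLp a b i) f := by
    have h1 : Summable fun i => ‖inner ℂ (gaborSystem hg.memLp a b i) f'‖ ^ 2 :=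
      summable_of_sum_le (fun i => by positivity) (hbes g hg f')
    have h2 : Summable fun i => ‖inner ℂ (gaborSystem hh.memLp a b i) f‖ ^ 2 :=
      summable_of_sum_le (fun i => by positivity) (hbes h hh f)
    refine Summable.of_norm_bounded (h1.add h2) fun i => ?_
    rw [norm_mul, norm_inner_symm]
    nlinarith [sq_nonneg (‖inner ℂ (gaborSystem hg.memLp a b i) f'‖ -
      ‖inner ℂ (gaborSystem hh.memLp a b i) f‖),
      sq_nonneg (‖inner ℂ (gaborSystem hg.memLp a b i) f'‖ +
      ‖inner ℂ (gaborSystem hh.memLp a b i) f‖)]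
  set I : ℤ → ℤ → ℝ → ℂ := fun l n x =>
    g (x - n * a) * conj (h (x + l * (1 / b) - n * a)) * (conj (f' x) * f (x + l * (1 / b))) with hI
  -- Parseval in m for each fixed n. Summing over n afterwards brings in the duality relations,
  -- which leave only l = 0.
  have hfib : ∀ n : ℤ, HasSum (fun m : ℤ => inner ℂ f' (gaborSystem hg.memLp a b (m, n)) *
      inner ℂ (gaborSystem hh.memLp a b (m, n)) f)
      (((1 / b : ℝ) : ℂ) * ∑ l ∈ Finset.Icc (-N : ℤ) N, ∫ x, I l n x) := by
    intro n
    refine hasSum_of_hasSum_of_eq (hasSum_conj_expCoeff_mul hT (mul_one_div_cancel hb.ne')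
      (hg.memLp_conj_translate_mul (n * a) (Lp.memLp f'))
      (hg.conj_translate_mul_eq_zero hN' (n * a) f')
      (hh.memLp_conj_translate_mul (n * a) (Lp.memLp f))
      (hh.conj_translate_mul_eq_zero hN' (n * a) f)) (fun m => ?_) ?_
    · rw [← inner_gaborSystem hg.memLp, ← inner_gaborSystem hh.memLp, inner_conj_symm]
    · congr 1
      refine Finset.sum_congr rfl fun l _ => integral_congr_ae (Eventually.of_forall fun x => ?_)
      simp only [hI, map_mul, Complex.conj_conj]
      ring
  have hff : ∀ l : ℤ, Integrable fun x => conj (f' x) * f (x + l * (1 / b)) := fun l =>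
    (Lp.memLp f').star.integrable_mul
      ((Lp.memLp f).comp_measurePreserving (measurePreserving_add_right volume _))
  have hsumn : ∀ l : ℤ, HasSum (fun n : ℤ => ∫ x, I l n x)
      (if l = 0 then (b : ℂ) * inner ℂ f' f else 0) := by
    intro l
    obtain ⟨K, hK, hw⟩ := exists_sum_translates_le ha ρ (C * C) (by positivity)
    have hgh : ∀ n : ℤ, AEStronglyMeasurable
        (fun x => g (x - n * a) * conj (h (x + l * (1 / b) - n * a))) volume := by
      intro n
      refine (memLp_gaborTranslate hg.memLp (n * a)).aestronglyMeasurable.mul ?_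
      have := (hh.memLp.star.comp_measurePreserving
        (measurePreserving_add_right volume (l * (1 / b) - n * a))).aestronglyMeasurable
      convert this using 2 with x
      simp only [Function.comp, Pi.star_apply, RCLike.star_def, add_sub_assoc]
    have hIint : ∀ n : ℤ, Integrable (I l n) := by
      intro n
      refine (hff l).bdd_mul (c := C * C) (hgh n) (Eventually.of_forall fun x => ?_)
      rw [norm_mul, RCLike.norm_conj]
      exact mul_le_mul (hg.norm_le _) (hh.norm_le _) (norm_nonneg _) hC
    have hIsum : Summable fun n : ℤ => ∫ x, ‖I l n x‖ := by
      refine summable_of_sum_le (c := ∫ x, K * ‖conj (f' x) * f (x + l * (1 / b))‖)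
        (fun n => integral_nonneg fun x => norm_nonneg _) fun S => ?_
      rw [← integral_finsetSum _ fun n _ => (hIint n).norm]
      refine integral_mono (integrable_finsetSum _ fun n _ => (hIint n).norm)
        ((hff l).norm.const_mul _) fun x => ?_
      simp only [hI, norm_mul _ (conj (f' x) * _)]
      rw [← Finset.sum_mul]
      refine mul_le_mul_of_nonneg_right ?_ (norm_nonneg _)
      refine le_of_eq_of_le (Finset.sum_congr rfl fun n _ => ?_)
        (hw (fun y => ‖g y * conj (h (y + l * (1 / b)))‖) (fun y => ?_) (fun y hy => ?_) x S)
      · congr 4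
        ring
      · rw [norm_mul, RCLike.norm_conj]
        exact mul_le_mul (hg.norm_le _) (hh.norm_le _) (norm_nonneg _) hC
      · simp [hg.eq_zero y hy]
    refine hasSum_of_hasSum_of_eq (hasSum_integral_of_summable_integral_norm hIint hIsum)
      (fun n => rfl) ?_
    have hts : ∀ x, ∑' n, I l n x
        = (if l = 0 then (b : ℂ) else 0) * (conj (f' x) * f (x + l * (1 / b))) := fun x =>
      ((hd x l).mul_right _).tsum_eq
    simp only [hts]
    split_ifs with hl
    · subst hl
      rw [integral_const_mul, MeasureTheory.L2.inner_def]
      congr 1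
      refine integral_congr_ae (Eventually.of_forall fun x => ?_)
      simp [RCLike.inner_apply, mul_comm]
    · simp
  have htot : HasSum (fun n : ℤ => ((1 / b : ℝ) : ℂ) * ∑ l ∈ Finset.Icc (-N : ℤ) N, ∫ x, I l n x)
      (inner ℂ f' f) := by
    refine hasSum_of_hasSum_of_eq ((hasSum_sum fun l (_ : l ∈ Finset.Icc (-N : ℤ) N) =>
      hsumn l).mul_left ((1 / b : ℝ) : ℂ)) (fun n => rfl) ?_
    rw [Finset.sum_ite_eq' _ (0 : ℤ), if_pos (Finset.mem_Icc.2 (by constructor <;> simp))]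
    push_cast
    field_simp
  -- Absolute summability over ℤ × ℤ allows summing over m first; the swap makes m the inner index.
  have hswap : HasSum (fun i : ℤ × ℤ => inner ℂ f' (gaborSystem hg.memLp a b i.swap) *
      inner ℂ (gaborSystem hh.memLp a b i.swap) f)
      (∑' i, inner ℂ f' (gaborSystem hg.memLp a b i) * inner ℂ (gaborSystem hh.memLp a b i) f) :=
    (Equiv.prodComm ℤ ℤ).hasSum_iff.2 hsum.hasSum
  rw [← (hswap.prod_fiberwise hfib).unique htot]
  exact hsum.hasSum

end IsCompactWindow

end GaborSystems

/-! ### A frame satisfies the chain condition. -/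

section Necessity

open scoped ComplexConjugate

/-- The set where g ≠ 0 is open, so it lies in the interior of [-α, α]; hence g vanishes at the
endpoints ±α too. -/
theorem WindowClass.eq_zero {α : ℝ} {g : ℝ → ℂ} (hg : WindowClass α g) {x : ℝ} (hx : α ≤ |x|) :
    g x = 0 := by
  by_contra hne
  have h1 : Function.support g ⊆ interior (Icc (-α) α) :=
    interior_maximal (hg.tsupport_eq ▸ subset_tsupport g) hg.continuous.isOpen_support
  have h2 := h1 hne
  rw [interior_Icc] at h2
  exact absurd (abs_lt.2 h2) (not_lt.2 hx)

/-- No chain of overlaps of step `δ` starts at a zero of `g` in `[0, a]` and ends at a zero of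
`g (· - a)`. -/
def ChainCondition (g : ℝ → ℂ) (a δ : ℝ) : Prop :=
  ∀ (n : ℕ) (y : ℝ), 0 ≤ y → y + n * δ ≤ a → g y ≠ 0 ∨ g (y + n * δ - a) ≠ 0

/-- The coefficients of the kernel vector along a chain starting at `s`. -/
noncomputable def chainCoeff (g : ℝ → ℂ) (a δ s : ℝ) : ℕ → ℂ
  | 0 => 1
  | r + 1 => -(chainCoeff g a δ s r * g (s + r * δ - a)) / g (s + (r + 1 : ℕ) * δ)

/-- Take n minimal: a zero of g at s + rδ with r ≥ 1 would start a shorter forbidden chain with the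
same end. The nonvanishing makes the divisions in `chainCoeff` legitimate. -/
theorem exists_minimal_chain {g : ℝ → ℂ} {a δ : ℝ} (hδ : 0 < δ) (h : ¬ ChainCondition g a δ) :
    ∃ (n : ℕ) (s : ℝ), 0 ≤ s ∧ s + n * δ ≤ a ∧ g s = 0 ∧ g (s + n * δ - a) = 0 ∧
      ∀ r : ℕ, 1 ≤ r → r ≤ n → g (s + r * δ) ≠ 0 := by
  classical
  have h1 : ∃ n : ℕ, ∃ s : ℝ, 0 ≤ s ∧ s + n * δ ≤ a ∧ g s = 0 ∧ g (s + n * δ - a) = 0 := by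
    simpa only [ChainCondition, not_forall, not_or, not_not, exists_prop] using h
  obtain ⟨s, hs0, hsa, hgs, hge⟩ := Nat.find_spec h1
  refine ⟨Nat.find h1, s, hs0, hsa, hgs, hge, fun r hr hrn hz => ?_⟩
  refine Nat.find_min h1 (m := Nat.find h1 - r) (by omega) ⟨s + r * δ, by positivity, ?_, hz, ?_⟩
  · rw [Nat.cast_sub hrn]; linarith
  · convert hge using 2
    rw [Nat.cast_sub hrn]; ring

/-- Since g vanishes outside (-a, a), only j = q and j = q - 1 contribute. Their two terms cancel by
the recursion for 1 ≤ q ≤ n. At q = 0 and q = n + 1 a single term remains, and it vanishes because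
the chain begins and ends at zeros. -/
theorem sum_chainCoeff_mul_eq_zero {g : ℝ → ℂ} {α a δ s : ℝ} {n : ℕ}
    (hz : ∀ x, α ≤ |x| → g x = 0) (hα : 0 < α) (ha : α ≤ a) (hδ : 0 < δ) (hs : 0 ≤ s)
    (hsn : s + n * δ ≤ a) (hgs : g s = 0) (hge : g (s + n * δ - a) = 0)
    (hne : ∀ r : ℕ, 1 ≤ r → r ≤ n → g (s + r * δ) ≠ 0) (q : ℤ) :
    ∑ j ∈ Finset.range (n + 1), chainCoeff g a δ s j * g (s + j * (a + δ) - q * a) = 0 := by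
  have hoff : ∀ j ∈ Finset.range (n + 1), (j : ℤ) ≠ q → (j : ℤ) + 1 ≠ q →
      chainCoeff g a δ s j * g (s + j * (a + δ) - q * a) = 0 := by
    intro j hj h1 h2
    have hjn : (j : ℝ) ≤ n := by exact_mod_cast Nat.lt_succ_iff.1 (Finset.mem_range.1 hj)
    have hj0 : 0 ≤ (j : ℝ) * δ := by positivity
    have hjδ : (j : ℝ) * δ ≤ n * δ := by gcongr
    rw [hz, mul_zero]
    have ha0 : 0 < a := by linarith
    rcases lt_or_ge q j with hq | hq
    · have h3 : (q : ℝ) + 1 ≤ j := by exact_mod_cast hq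
      rw [le_abs]; left
      nlinarith
    · have h3 : (j : ℝ) + 2 ≤ q := by
        have : (j : ℤ) + 2 ≤ q := by omega
        exact_mod_cast this
      rw [le_abs]; right
      nlinarith
  rcases lt_trichotomy q 0 with hq | hq | hq
  · exact Finset.sum_eq_zero fun j hj => hoff j hj (by omega) (by omega)
  · subst hq
    refine Finset.sum_eq_zero fun j hj => ?_
    rcases Nat.eq_zero_or_pos j with rfl | hj0
    · simp [hgs]
    · exact hoff j hj (by omega) (by omega)
  · obtain ⟨r, rfl⟩ : ∃ r : ℕ, q = (r : ℤ) + 1 := ⟨(q - 1).toNat, by omega⟩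
    rcases lt_trichotomy r n with hr | rfl | hr
    · rw [Finset.sum_eq_add_of_mem r (r + 1) (Finset.mem_range.2 (by omega))
        (Finset.mem_range.2 (by omega)) (by omega)
        fun j hj hjr => hoff j hj (by omega) (by omega)]
      have h1 : s + (r : ℝ) * (a + δ) - ((r : ℤ) + 1 : ℤ) * a = s + r * δ - a := by
        push_cast; ring
      have h2 : s + ((r + 1 : ℕ) : ℝ) * (a + δ) - ((r : ℤ) + 1 : ℤ) * a = s + (r + 1 : ℕ) * δ := by
        push_cast; ring
      rw [h1, h2, chainCoeff, div_mul_cancel₀ _ (hne (r + 1) (by omega) (by omega))]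
      ring
    · refine Finset.sum_eq_zero fun j hj => ?_
      by_cases hjr : j = r
      · subst hjr
        have h1 : s + (j : ℝ) * (a + δ) - ((j : ℤ) + 1 : ℤ) * a = s + j * δ - a := by
          push_cast; ring
        rw [h1, hge, mul_zero]
      · have := Finset.mem_range.1 hj
        exact hoff j hj (by omega) (by omega)
    · refine Finset.sum_eq_zero fun j hj => ?_
      have := Finset.mem_range.1 hj
      exact hoff j hj (by omega) (by omega)

/-- A combination of translates by multiples of `T` of the indicator of `(s - ε, s + ε]`. -/
noncomputable def combFun (c : ℕ → ℂ) (n : ℕ) (T s ε : ℝ) (x : ℝ) : ℂ :=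
  ∑ j ∈ Finset.range n, conj (c j) * (Ioc (s - ε) (s + ε)).indicator 1 (x - j * T)

theorem memLp_combFun (c : ℕ → ℂ) (n : ℕ) (T s ε : ℝ) : MemLp (combFun c n T s ε) 2 volume := by
  refine memLp_finsetSum _ fun j _ => MemLp.const_mul ?_ _
  have h : MemLp ((Ioc (s - ε) (s + ε)).indicator (1 : ℝ → ℂ)) 2 volume :=
    memLp_indicator_const 2 measurableSet_Ioc 1 (Or.inr (by simp))
  exact h.comp_measurePreserving (measurePreserving_sub_right volume (j * T))

/-- The bumps have length 2ε ≤ T, so on each period exactly one of them is seen. -/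
theorem combFun_add {c : ℕ → ℂ} {n : ℕ} {T s ε : ℝ} (hT : 2 * ε ≤ T) {k : ℕ} (hk : k < n) {x : ℝ}
    (hx : x ∈ Ioc (s - ε) (s - ε + T)) :
    combFun c n T s ε (x + k * T) = conj (c k) * (Ioc (s - ε) (s + ε)).indicator 1 x := by
  have hT0 : 0 < T := by linarith [hx.1, hx.2]
  rw [combFun, Finset.sum_eq_single k]
  · congr 2; ring
  · intro j _ hjk
    rw [indicator_of_notMem, mul_zero]
    rintro ⟨h1, h2⟩
    rcases lt_or_gt_of_ne hjk with h | h
    · have h3 : (j : ℝ) + 1 ≤ k := by exact_mod_cast h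
      nlinarith [hx.1, hx.2]
    · have h3 : (k : ℝ) + 1 ≤ j := by exact_mod_cast h
      nlinarith [hx.1, hx.2]
  · intro h; exact absurd (Finset.mem_range.2 hk) h

theorem combFun_eq_zero {c : ℕ → ℂ} {n : ℕ} {T s ε : ℝ} (hε : 0 < ε) (hT : 2 * ε ≤ T) {x : ℝ}
    (hx : x ∉ Ioc (s - ε) (s - ε + n * T)) : combFun c n T s ε x = 0 := by
  refine Finset.sum_eq_zero fun j hj => ?_
  rw [indicator_of_notMem, mul_zero]
  rintro ⟨h1, h2⟩
  have h3 : (j : ℝ) + 1 ≤ n := by exact_mod_cast Finset.mem_range.1 hj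
  refine hx ⟨by nlinarith [mul_nonneg j.cast_nonneg (by linarith : 0 ≤ T)], by nlinarith⟩

theorem two_mul_le_norm_sq_combFun {c : ℕ → ℂ} {n : ℕ} {T s ε : ℝ} (hε : 0 < ε) (hT : 2 * ε ≤ T)
    (hn : 0 < n) (hc : c 0 = 1) : 2 * ε ≤ ‖(memLp_combFun c n T s ε).toLp‖ ^ 2 := by
  rw [norm_sq_eq_integral_norm_sq]
  have h1 : ∫ x, ‖(memLp_combFun c n T s ε).toLp (combFun c n T s ε) x‖ ^ 2
      = ∫ x, ‖combFun c n T s ε x‖ ^ 2 := by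
    refine integral_congr_ae ?_
    filter_upwards [(memLp_combFun c n T s ε).coeFn_toLp] with x hx
    rw [hx]
  have h2 : ∫ x in Ioc (s - ε) (s + ε), ‖combFun c n T s ε x‖ ^ 2
      = ∫ x in Ioc (s - ε) (s + ε), (1 : ℝ) := by
    refine setIntegral_congr_fun measurableSet_Ioc fun x hx => ?_
    have h3 := combFun_add (c := c) hT hn (x := x) ⟨hx.1, by linarith [hx.2]⟩
    simp only [Nat.cast_zero, zero_mul, add_zero] at h3
    simp [h3, hc, indicator_of_mem hx]
  rw [h1]
  refine le_trans (le_of_eq ?_) (setIntegral_le_integral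
    ((memLp_combFun c n T s ε).integrable_norm_pow (by norm_num))
    (Eventually.of_forall fun x => by positivity) (s := Ioc (s - ε) (s + ε)))
  rw [h2]
  simp
  rw [max_eq_left (by linarith)]
  ring

theorem IsFrame.chainCondition {g : ℝ → ℂ} {α C a b : ℝ} (hg : IsCompactWindow g α C)
    (hc : Continuous g) (hα : 0 < α) (ha : α ≤ a) (hb : 0 < b)
    (hδ : 0 < 1 / b - a) (hF : IsFrame (gaborSystem hg.memLp a b)) :
    ChainCondition g a (1 / b - a) := by
  have hz := hg.eq_zero
  by_contra hcon
  obtain ⟨A, B, hA, -, hF⟩ := hF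
  obtain ⟨n, s, hs, hsn, hgs, hge, hne⟩ := exists_minimal_chain hδ hcon
  have ha0 : 0 < a := hα.trans_le ha
  have hT : 0 < 1 / b := by positivity
  set T := 1 / b with hTdef
  set c := chainCoeff g a (T - a) s with hcdef
  have hzero : ∀ q : ℤ, ∑ j ∈ Finset.range (n + 1), c j * g (s + j * T - q * a) = 0 := by
    intro q
    have := sum_chainCoeff_mul_eq_zero hz hα ha hδ hs hsn hgs hge hne q
    rwa [add_sub_cancel] at this
  -- For |q| ≥ R the translate of g by qa misses all the bumps, so only 2R + 1 values of q matter.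
  obtain ⟨R, hR⟩ := exists_nat_gt ((s + T + n * T + α) / a)
  rw [div_lt_iff₀ ha0] at hR
  -- Chosen so that the total over all q is at most Aε, while the lower frame bound demands at least
  -- 2Aε.
  set η := A / (2 * (2 * R + 1) * T) with hη
  have hη0 : 0 < η := by positivity
  have hev : ∀ᶠ x in 𝓝 s, ∀ q ∈ Finset.Icc (-R : ℤ) R,
      ‖∑ j ∈ Finset.range (n + 1), c j * g (x + j * T - q * a)‖ ^ 2 < η := by
    rw [Finset.eventually_all]
    intro q _
    have hcont : Continuous fun x =>
        ‖∑ j ∈ Finset.range (n + 1), c j * g (x + j * T - q * a)‖ ^ 2 := by fun_prop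
    refine hcont.continuousAt.eventually_lt_const ?_
    simpa only [hzero q, norm_zero, zero_pow two_ne_zero] using hη0
  obtain ⟨ε₀, hε₀, hball⟩ := Metric.eventually_nhds_iff.1 hev
  set ε := min (ε₀ / 2) (T / 2) with hε
  have hε0 : 0 < ε := by positivity
  have hεT : 2 * ε ≤ T := by have := min_le_right (ε₀ / 2) (T / 2); linarith
  have hεε : ε < ε₀ := by have := min_le_left (ε₀ / 2) (T / 2); linarith
  set f := (memLp_combFun c (n + 1) T s ε).toLp with hf
  -- Periodizing the product of f with a translate of g produces the kernel sum, which vanishes at s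
  -- and is therefore small near s.
  have hperL : ∀ q : ℤ, ∀ x ∈ Ioc (s - ε) (s - ε + T),
      periodize T (n + 1) (fun x => conj (g (x - q * a)) * combFun c (n + 1) T s ε x) x
        = conj (∑ j ∈ Finset.range (n + 1), c j * g (x + j * T - q * a)) *
          (Ioc (s - ε) (s + ε)).indicator 1 x := by
    intro q x hx
    rw [periodize, map_sum, Finset.sum_mul]
    refine Finset.sum_congr rfl fun k hk => ?_
    rw [combFun_add hεT (Finset.mem_range.1 hk) hx, map_mul]
    ring
  have hrow : ∀ (q : ℤ) (S : Finset ℤ), ∑ m ∈ S, ‖inner ℂ (gaborSystem hg.memLp a b (m, q)) f‖ ^ 2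
      ≤ if q ∈ Finset.Icc (-R : ℤ) R then T * (2 * ε * η) else 0 := by
    intro q S
    have hmem : MemLp (fun x => conj (g (x - q * a)) * combFun c (n + 1) T s ε x) 2 volume :=
      hg.memLp_conj_translate_mul _ (memLp_combFun _ _ _ _ _)
    have hS := hasSum_norm_sq_expCoeff (u := s - ε) (N := n + 1) hT
      (mul_one_div_cancel hb.ne') hmem fun x hx => by
        rw [combFun_eq_zero hε0 hεT hx, mul_zero]
    simp only [hf, inner_gaborSystem_toLp]
    refine (sum_le_hasSum S (fun _ _ => by positivity) hS).trans ?_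
    rw [intervalIntegral.integral_of_le (by linarith)]
    split_ifs with hq
    · refine mul_le_mul_of_nonneg_left ?_ hT.le
      have hind : Integrable ((Ioc (s - ε) (s + ε)).indicator fun _ : ℝ => η) :=
        (integrable_indicator_iff measurableSet_Ioc).2 (by simp)
      calc _ ≤ ∫ x in Ioc (s - ε) (s - ε + T), (Ioc (s - ε) (s + ε)).indicator (fun _ => η) x := by
            refine setIntegral_mono_on
              ((memLp_periodize hmem).integrable_norm_pow (by norm_num)).integrableOn
              hind.integrableOn measurableSet_Ioc fun x hx => ?_
            rw [hperL q x hx]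
            by_cases hxV : x ∈ Ioc (s - ε) (s + ε)
            · rw [indicator_of_mem hxV, indicator_of_mem hxV, Pi.one_apply, mul_one,
                RCLike.norm_conj]
              refine (hball ?_ q hq).le
              rw [Real.dist_eq, abs_lt]
              constructor <;> linarith [hxV.1, hxV.2]
            · simp [indicator_of_notMem hxV]
        _ ≤ ∫ x, (Ioc (s - ε) (s + ε)).indicator (fun _ => η) x :=
            setIntegral_le_integral hind
              (Eventually.of_forall fun x => indicator_nonneg (fun _ _ => hη0.le) x)
        _ = 2 * ε * η := by
            rw [integral_indicator measurableSet_Ioc, setIntegral_const, Real.volume_real_Ioc,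
              max_eq_left (by linarith), smul_eq_mul]
            ring
    · have h0 : ∀ x ∈ Ioc (s - ε) (s - ε + T), ‖periodize T (n + 1)
          (fun x => conj (g (x - q * a)) * combFun c (n + 1) T s ε x) x‖ ^ 2 = 0 := by
        intro x hx
        rw [hperL q x hx]
        by_cases hxV : x ∈ Ioc (s - ε) (s + ε)
        · rw [Finset.sum_eq_zero, map_zero, zero_mul, norm_zero, zero_pow two_ne_zero]
          intro j hj
          have hjn : (j : ℝ) ≤ n := by exact_mod_cast Nat.lt_succ_iff.1 (Finset.mem_range.1 hj)
          have hj0 : 0 ≤ (j : ℝ) * T := by positivity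
          have hjT : (j : ℝ) * T ≤ n * T := by gcongr
          rw [hz, mul_zero]
          rw [Finset.mem_Icc, not_and_or, not_le, not_le] at hq
          rcases hq with hq | hq
          · have h3 : (q : ℝ) ≤ -R := by exact_mod_cast hq.le
            rw [le_abs]; left
            nlinarith [hxV.1]
          · have h3 : (R : ℝ) ≤ q := by exact_mod_cast hq.le
            rw [le_abs]; right
            nlinarith [hxV.2]
        · simp [indicator_of_notMem hxV]
      rw [setIntegral_congr_fun measurableSet_Ioc h0]
      simp
  have htot : ∑' i, ‖inner ℂ (gaborSystem hg.memLp a b i) f‖ ^ 2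
      ≤ (2 * R + 1) * (T * (2 * ε * η)) := by
    refine (hF f).1.tsum_le_of_sum_le fun S => ?_
    calc ∑ i ∈ S, ‖inner ℂ (gaborSystem hg.memLp a b i) f‖ ^ 2
        ≤ ∑ i ∈ S.image Prod.fst ×ˢ S.image Prod.snd,
            ‖inner ℂ (gaborSystem hg.memLp a b i) f‖ ^ 2 :=
          Finset.sum_le_sum_of_subset_of_nonneg Finset.subset_product fun _ _ _ => by positivity
      _ = ∑ q ∈ S.image Prod.snd, ∑ m ∈ S.image Prod.fst,
            ‖inner ℂ (gaborSystem hg.memLp a b (m, q)) f‖ ^ 2 := Finset.sum_product_right _ _ _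
      _ ≤ ∑ q ∈ S.image Prod.snd, if q ∈ Finset.Icc (-R : ℤ) R then T * (2 * ε * η) else 0 :=
          Finset.sum_le_sum fun q _ => hrow q _
      _ ≤ ∑ q ∈ Finset.Icc (-R : ℤ) R, T * (2 * ε * η) := by
          rw [← Finset.sum_filter]
          exact Finset.sum_le_sum_of_subset_of_nonneg
            (fun q hq => (Finset.mem_filter.1 hq).2) fun _ _ _ => by positivity
      _ = (2 * R + 1) * (T * (2 * ε * η)) := by
          rw [Finset.sum_const, Int.card_Icc, nsmul_eq_mul]
          congr 1
          have : ((R : ℤ) + 1 - -R).toNat = 2 * R + 1 := by omega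
          rw [this]; push_cast; ring
  have hnorm : 2 * ε ≤ ‖f‖ ^ 2 := two_mul_le_norm_sq_combFun hε0 hεT (Nat.succ_pos n) rfl
  have hlow := (hF f).2.1
  have hηT : (2 * (R : ℝ) + 1) * (T * (2 * ε * η)) = A * ε := by
    rw [hη]; field_simp
  nlinarith [mul_le_mul_of_nonneg_left hnorm hA.le, mul_pos hA hε0]

end Necessity

/-! ### Construction of a dual window from the chain condition. -/

section DualWindow

open scoped ComplexConjugate

/-- The chain condition holds with a uniform lower bound, by compactness. -/
theorem ChainCondition.exists_bound {g : ℝ → ℂ} {a δ : ℝ} (hc : Continuous g)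
    (h : ChainCondition g a δ) (M : ℕ) :
    ∃ ε : ℝ, 0 < ε ∧ ∀ n < M, ∀ y : ℝ, 0 ≤ y → y + n * δ ≤ a →
      ε ≤ ‖g y‖ ∨ ε ≤ ‖g (y + n * δ - a)‖ := by
  have h1 : ∀ n : ℕ, ∃ ε : ℝ, 0 < ε ∧ ∀ y : ℝ, 0 ≤ y → y + n * δ ≤ a →
      ε ≤ ‖g y‖ ∨ ε ≤ ‖g (y + n * δ - a)‖ := by
    intro n
    rcases (Icc (0 : ℝ) (a - n * δ)).eq_empty_or_nonempty with he | hne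
    · refine ⟨1, one_pos, fun y hy hy' => ?_⟩
      have : y ∈ Icc (0 : ℝ) (a - n * δ) := ⟨hy, by linarith⟩
      rw [he] at this
      exact this.elim
    · have hcont : Continuous fun y => max ‖g y‖ ‖g (y + n * δ - a)‖ := by fun_prop
      obtain ⟨y₀, hy₀, hmin⟩ := isCompact_Icc.exists_isMinOn hne hcont.continuousOn
      refine ⟨_, ?_, fun y hy hy' => le_max_iff.1 (hmin (show y ∈ Icc _ _ from ⟨hy, by linarith⟩))⟩
      rcases h n y₀ hy₀.1 (by linarith [hy₀.2]) with h2 | h2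
      · exact lt_max_of_lt_left (norm_pos_iff.2 h2)
      · exact lt_max_of_lt_right (norm_pos_iff.2 h2)
  choose ε hε hε' using h1
  obtain ⟨ε₀, hε₀, hle⟩ : ∃ ε₀ : ℝ, 0 < ε₀ ∧ ∀ n < M, ε₀ ≤ ε n := by
    induction M with
    | zero => exact ⟨1, one_pos, fun n hn => absurd hn (Nat.not_lt_zero n)⟩
    | succ M ih =>
      obtain ⟨ε₀, hε₀, hle⟩ := ih
      refine ⟨min ε₀ (ε M), lt_min hε₀ (hε M), fun n hn => ?_⟩
      rcases Nat.lt_succ_iff_lt_or_eq.1 hn with hn | rfl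
      · exact (min_le_left _ _).trans (hle n hn)
      · exact min_le_right _ _
  exact ⟨ε₀, hε₀, fun n hn y hy hy' =>
    (hε' n y hy hy').imp (hle n hn).trans (hle n hn).trans⟩

/-- The points from which the chain relations can be solved forwards. -/
def forwardSet (g : ℝ → ℂ) (δ ε : ℝ) (M : ℕ) : Set ℝ :=
  {t | ∀ i < M, (i : ℝ) * δ ≤ t → ε ≤ ‖g (t - i * δ)‖}

/-- The coefficients of the forward solution of the chain relations. -/
noncomputable def forwardCoeff (g : ℝ → ℂ) (a δ : ℝ) (q : ℕ) (t : ℝ) : ℂ :=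
  1 / g (t - q * δ) * ∏ p ∈ Finset.range q, (-g (t - (p + 1) * δ - a) / g (t - p * δ))

/-- The coefficients of the backward solution of the chain relations. -/
noncomputable def backwardCoeff (g : ℝ → ℂ) (a δ : ℝ) (l : ℕ) (t : ℝ) : ℂ :=
  1 / g (t + l * δ - a) * ∏ p ∈ Finset.range l, (-g (t + (p + 1) * δ) / g (t + p * δ - a))

/-- A left inverse of the chain relations, as a family of functions on `[0, a)`. -/
noncomputable def chainInverse (g : ℝ → ℂ) (a δ ε : ℝ) (M : ℕ) : ℤ → ℝ → ℂ
  | Int.ofNat q => (forwardSet g δ ε M ∩ {t | q * δ ≤ t}).indicator (forwardCoeff g a δ q)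
  | Int.negSucc l => ((forwardSet g δ ε M)ᶜ ∩ {t | t + l * δ < a}).indicator (backwardCoeff g a δ l)

/-- The dual window assembled from `chainInverse`. -/
noncomputable def chainDual (g : ℝ → ℂ) (a b δ ε : ℝ) (M : ℕ) (u : ℝ) : ℂ :=
  b * conj (chainInverse g a δ ε M ⌊u / a⌋ (u - ⌊u / a⌋ * a))

theorem measurableSet_forwardSet {g : ℝ → ℂ} (hc : Continuous g) (δ ε : ℝ) (M : ℕ) :
    MeasurableSet (forwardSet g δ ε M) := by
  simp only [forwardSet, ofPred_forall]
  refine MeasurableSet.iInter fun i => MeasurableSet.iInter fun _ => ?_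
  have : {t : ℝ | (i : ℝ) * δ ≤ t → ε ≤ ‖g (t - i * δ)‖}
      = {t : ℝ | (i : ℝ) * δ ≤ t}ᶜ ∪ {t : ℝ | ε ≤ ‖g (t - i * δ)‖} := by
    ext t; simp only [mem_ofPred_eq, mem_union, mem_compl_iff]; tauto
  rw [this]
  exact (measurableSet_le measurable_const measurable_id).compl.union
    (isClosed_le continuous_const (by fun_prop)).measurableSet

theorem measurable_chainInverse {g : ℝ → ℂ} (hc : Continuous g) (a δ ε : ℝ) (M : ℕ) (k : ℤ) :
    Measurable (chainInverse g a δ ε M k) := by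
  have hm := hc.measurable
  cases k with
  | ofNat q =>
    refine Measurable.indicator ?_ ((measurableSet_forwardSet hc δ ε M).inter
      (measurableSet_le measurable_const measurable_id))
    unfold forwardCoeff
    fun_prop
  | negSucc l =>
    refine Measurable.indicator ?_ ((measurableSet_forwardSet hc δ ε M).compl.inter
      (measurableSet_lt (by fun_prop) measurable_const))
    unfold backwardCoeff
    fun_prop

theorem measurable_chainDual {g : ℝ → ℂ} (hc : Continuous g) (a b δ ε : ℝ) (M : ℕ) :
    Measurable (chainDual g a b δ ε M) := by
  have h1 : Measurable fun p : ℤ × ℝ => chainInverse g a δ ε M p.1 p.2 :=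
    measurable_from_prod_countable_right fun k => measurable_chainInverse hc a δ ε M k
  have h2 : Measurable fun u : ℝ => ((⌊u / a⌋, u - ⌊u / a⌋ * a) : ℤ × ℝ) := by fun_prop
  exact (Complex.continuous_conj.measurable.comp (h1.comp h2)).const_mul _

/-- A failure of the forward solution is a small value of g at some t - iδ. The chain of i + l steps
from there ends at t + lδ, and the quantitative chain condition keeps g(t + lδ - a) away from 0.
Thus the backward solution works wherever the forward one is rejected. -/
theorem le_norm_of_notMem_forwardSet {g : ℝ → ℂ} {a δ ε : ℝ} {M : ℕ} (hδ : 0 < δ) (hM : a < M * δ)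
    (hε : ∀ n < M, ∀ y : ℝ, 0 ≤ y → y + n * δ ≤ a → ε ≤ ‖g y‖ ∨ ε ≤ ‖g (y + n * δ - a)‖)
    {t : ℝ} (ht : t ∉ forwardSet g δ ε M) (l : ℕ) (hl : t + l * δ < a) :
    ε ≤ ‖g (t + l * δ - a)‖ := by
  simp only [forwardSet, mem_ofPred_eq, not_forall, not_le] at ht
  obtain ⟨i, hi, hit, hlt⟩ := ht
  have h1 : t - i * δ + ((i + l : ℕ) : ℝ) * δ = t + l * δ := by push_cast; ring
  have h2 : i + l < M := by
    have : ((i + l : ℕ) : ℝ) * δ < M * δ := by linarith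
    exact_mod_cast lt_of_mul_lt_mul_right this hδ.le
  rcases hε (i + l) h2 (t - i * δ) (by linarith) (by linarith) with h3 | h3
  · exact absurd h3 (not_le.2 hlt)
  · rwa [h1] at h3

theorem le_norm_of_mem_forwardSet {g : ℝ → ℂ} {a δ ε : ℝ} {M : ℕ} (hδ : 0 < δ) (hM : a < M * δ)
    {t : ℝ} (hta : t < a) (ht : t ∈ forwardSet g δ ε M) (q : ℕ) (hq : q * δ ≤ t) :
    ε ≤ ‖g (t - q * δ)‖ := by
  refine ht q ?_ hq
  have : (q : ℝ) * δ < M * δ := by linarith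
  exact_mod_cast lt_of_mul_lt_mul_right this hδ.le

theorem norm_one_div_mul_prod_le {ε C : ℝ} (hε : 0 < ε) {q M : ℕ} (hq : q ≤ M) {z : ℂ}
    {u v : ℕ → ℂ} (hz : ε ≤ ‖z‖) (hu : ∀ p < q, ‖u p‖ ≤ C) (hv : ∀ p < q, ε ≤ ‖v p‖) :
    ‖1 / z * ∏ p ∈ Finset.range q, (-u p / v p)‖ ≤ 1 / ε * max 1 (C / ε) ^ M := by
  rw [norm_mul, norm_div, norm_one, norm_prod]
  gcongr
  calc ∏ p ∈ Finset.range q, ‖-u p / v p‖ ≤ ∏ p ∈ Finset.range q, max 1 (C / ε) := by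
        refine Finset.prod_le_prod (fun _ _ => norm_nonneg _) fun p hp => ?_
        have hp' := Finset.mem_range.1 hp
        rw [norm_div, norm_neg]
        refine le_max_of_le_right ?_
        have hC : 0 ≤ C := (norm_nonneg _).trans (hu p hp')
        exact div_le_div₀ hC (hu p hp') hε (hv p hp')
    _ = max 1 (C / ε) ^ q := by simp
    _ ≤ max 1 (C / ε) ^ M := pow_le_pow_right₀ (le_max_left _ _) hq

/-- Each recursion takes at most M steps, because a < Mδ, and every denominator is at least ε in
modulus. -/
theorem norm_chainInverse_le {g : ℝ → ℂ} {a δ ε C : ℝ} {M : ℕ} (hδ : 0 < δ) (hM : a < M * δ)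
    (hε0 : 0 < ε) (hC : ∀ x, ‖g x‖ ≤ C)
    (hε : ∀ n < M, ∀ y : ℝ, 0 ≤ y → y + n * δ ≤ a → ε ≤ ‖g y‖ ∨ ε ≤ ‖g (y + n * δ - a)‖)
    (k : ℤ) {t : ℝ} (ht : 0 ≤ t) (hta : t < a) :
    ‖chainInverse g a δ ε M k t‖ ≤ 1 / ε * max 1 (C / ε) ^ M := by
  have hpos : 0 ≤ 1 / ε * max 1 (C / ε) ^ M := by positivity
  cases k with
  | ofNat q =>
    by_cases hm : t ∈ forwardSet g δ ε M ∩ {t | q * δ ≤ t}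
    · rw [chainInverse, indicator_of_mem hm]
      obtain ⟨hm1, hm2⟩ := hm
      have hm2 : (q : ℝ) * δ ≤ t := hm2
      have hqM : q ≤ M := by
        have : (q : ℝ) * δ < M * δ := by linarith
        exact_mod_cast (lt_of_mul_lt_mul_right this hδ.le).le
      refine norm_one_div_mul_prod_le hε0 hqM (le_norm_of_mem_forwardSet hδ hM hta hm1 q hm2)
        (fun p _ => hC _) fun p hp => le_norm_of_mem_forwardSet hδ hM hta hm1 p ?_
      have : (p : ℝ) ≤ q := by exact_mod_cast hp.le
      nlinarith
    · rw [chainInverse, indicator_of_notMem hm, norm_zero]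
      exact hpos
  | negSucc l =>
    by_cases hm : t ∈ (forwardSet g δ ε M)ᶜ ∩ {t | t + l * δ < a}
    · rw [chainInverse, indicator_of_mem hm]
      obtain ⟨hm1, hm2⟩ := hm
      have hm2 : t + l * δ < a := hm2
      have hlM : l ≤ M := by
        have : (l : ℝ) * δ < M * δ := by linarith
        exact_mod_cast (lt_of_mul_lt_mul_right this hδ.le).le
      refine norm_one_div_mul_prod_le hε0 hlM (le_norm_of_notMem_forwardSet hδ hM hε hm1 l hm2)
        (fun p _ => hC _) fun p hp => le_norm_of_notMem_forwardSet hδ hM hε hm1 p ?_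
      have : (p : ℝ) ≤ l := by exact_mod_cast hp.le
      nlinarith
    · rw [chainInverse, indicator_of_notMem hm, norm_zero]
      exact hpos

theorem sub_floor_div_mul_mem {a : ℝ} (ha : 0 < a) (u : ℝ) :
    0 ≤ u - ⌊u / a⌋ * a ∧ u - ⌊u / a⌋ * a < a := by
  have h1 := (le_div_iff₀ ha).1 (Int.floor_le (u / a))
  have h2 := (div_lt_iff₀ ha).1 (Int.lt_floor_add_one (u / a))
  constructor <;> linarith

/-- On the k-th cell, k = q ≥ 0 requires qδ ≤ t < a < Mδ, so q ≤ M - 1; k = -(l + 1) requires lδ < a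
< Mδ, so l + 1 ≤ M. -/
theorem chainDual_eq_zero {g : ℝ → ℂ} {a b δ ε : ℝ} {M : ℕ} (ha : 0 < a) (hδ : 0 < δ)
    (hM : a < M * δ) {u : ℝ} (hu : u ∉ Ico (-(a * M)) (a * M)) : chainDual g a b δ ε M u = 0 := by
  obtain ⟨h1, h2⟩ := sub_floor_div_mul_mem ha u
  rw [chainDual]
  set k := ⌊u / a⌋ with hk
  set t := u - k * a with ht
  have hut : u = t + k * a := by rw [ht]; ring
  suffices h : chainInverse g a δ ε M k t = 0 by rw [h]; simp
  clear_value k t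
  cases k with
  | ofNat q =>
    refine indicator_of_notMem (fun hm => hu ?_) _
    have hm2 : (q : ℝ) * δ ≤ t := hm.2
    have hqM : (q : ℝ) + 1 ≤ M := by
      have : (q : ℝ) * δ < M * δ := by linarith
      exact_mod_cast lt_of_mul_lt_mul_right this hδ.le
    have hu' : u = t + q * a := by rw [hut]; simp
    constructor <;> nlinarith [mul_nonneg (Nat.cast_nonneg (α := ℝ) q) ha.le]
  | negSucc l =>
    refine indicator_of_notMem (fun hm => hu ?_) _
    have hm2 : t + l * δ < a := hm.2
    have hlM : (l : ℝ) + 1 ≤ M := by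
      have : (l : ℝ) * δ < M * δ := by linarith
      exact_mod_cast lt_of_mul_lt_mul_right this hδ.le
    have hu' : u = t - (l + 1) * a := by rw [hut]; push_cast; ring
    constructor <;> nlinarith [mul_nonneg (Nat.cast_nonneg (α := ℝ) l) ha.le]

theorem forwardCoeff_succ_mul {g : ℝ → ℂ} (a δ t : ℝ) (r : ℕ)
    (hr : g (t - (r + 1 : ℕ) * δ) ≠ 0) :
    g (t - (r + 1 : ℕ) * δ) * forwardCoeff g a δ (r + 1) t
      + g (t - (r + 1 : ℕ) * δ - a) * forwardCoeff g a δ r t = 0 := by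
  rw [forwardCoeff, ← mul_assoc, mul_one_div_cancel hr, one_mul, Finset.prod_range_succ,
    forwardCoeff]
  push_cast
  ring

theorem backwardCoeff_succ_mul {g : ℝ → ℂ} (a δ t : ℝ) (r : ℕ)
    (hr : g (t + (r + 1 : ℕ) * δ - a) ≠ 0) :
    g (t + (r + 1 : ℕ) * δ) * backwardCoeff g a δ r t
      + g (t + (r + 1 : ℕ) * δ - a) * backwardCoeff g a δ (r + 1) t = 0 := by
  have h1 : g (t + (r + 1 : ℕ) * δ - a) * backwardCoeff g a δ (r + 1) t
      = ∏ p ∈ Finset.range (r + 1), (-g (t + (p + 1) * δ) / g (t + p * δ - a)) := by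
    rw [backwardCoeff, ← mul_assoc, mul_one_div_cancel hr, one_mul]
  rw [h1, Finset.prod_range_succ, backwardCoeff]
  push_cast
  ring

/-- For every k other than l and l - 1, either the coefficient is zero or the argument of g lies
outside (-a, a). What remains is the two-term relation solved by the forward or the backward
recursion, with right-hand side 1 only at l = 0, where the recursion starts. -/
theorem hasSum_mul_chainInverse {g : ℝ → ℂ} {α a δ ε : ℝ} {M : ℕ}
    (hz : ∀ x, α ≤ |x| → g x = 0) (ha : α ≤ a) (hδ : 0 < δ) (hM : a < M * δ) (hε0 : 0 < ε)
    (hε : ∀ n < M, ∀ y : ℝ, 0 ≤ y → y + n * δ ≤ a → ε ≤ ‖g y‖ ∨ ε ≤ ‖g (y + n * δ - a)‖)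
    {t : ℝ} (ht : 0 ≤ t) (hta : t < a) (l : ℤ) :
    HasSum (fun k : ℤ => g (t - l * (a + δ) + k * a) * chainInverse g a δ ε M k t)
      (if l = 0 then 1 else 0) := by
  have hright : ∀ x, a ≤ x → g x = 0 := fun x hx => hz x (le_abs.2 (Or.inl (by linarith)))
  have hleft : ∀ x, x ≤ -a → g x = 0 := fun x hx => hz x (le_abs.2 (Or.inr (by linarith)))
  have hne : ∀ z : ℂ, ε ≤ ‖z‖ → z ≠ 0 := fun z hz => norm_pos_iff.1 (hε0.trans_le hz)
  have ha0 : 0 < a := ht.trans_lt hta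
  have hδl : ∀ {i j : ℤ}, i ≤ j → (i : ℝ) * δ ≤ j * δ := fun h => by
    have : ((_ : ℤ) : ℝ) ≤ ((_ : ℤ) : ℝ) := Int.cast_le.2 h
    exact mul_le_mul_of_nonneg_right this hδ.le
  have hal : ∀ {i j : ℤ}, i ≤ j → (i : ℝ) * a ≤ j * a := fun h => by
    have : ((_ : ℤ) : ℝ) ≤ ((_ : ℤ) : ℝ) := Int.cast_le.2 h
    exact mul_le_mul_of_nonneg_right this ha0.le
  by_cases hfw : t ∈ forwardSet g δ ε M
  · have hneg : ∀ m : ℕ, chainInverse g a δ ε M (Int.negSucc m) t = 0 := fun m =>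
      indicator_of_notMem (fun h => h.1 hfw) _
    have hlarge : ∀ q : ℕ, t < q * δ → chainInverse g a δ ε M q t = 0 := fun q hq =>
      indicator_of_notMem (fun h => absurd h.2 (not_le.2 hq)) _
    have hval : ∀ q : ℕ, q * δ ≤ t → chainInverse g a δ ε M q t = forwardCoeff g a δ q t :=
      fun q hq => indicator_of_mem (show t ∈ _ ∩ _ from ⟨hfw, hq⟩) _
    have hgne : ∀ q : ℕ, q * δ ≤ t → g (t - q * δ) ≠ 0 := fun q hq =>
      hne _ (le_norm_of_mem_forwardSet hδ hM hta hfw q hq)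
    refine hasSum_of_hasSum_of_eq (hasSum_sum_of_ne_finset_zero (s := {l, l - 1}) fun k hk => ?_)
      (fun k => rfl) ?_
    · rw [Finset.mem_insert, Finset.mem_singleton, not_or] at hk
      cases k with
      | negSucc m => rw [hneg, mul_zero]
      | ofNat q =>
        rcases lt_or_ge t (q * δ) with hq | hq
        · rw [Int.ofNat_eq_natCast, hlarge q hq, mul_zero]
        · rw [Int.ofNat_eq_natCast] at hk ⊢
          have hq0 : 0 ≤ (q : ℝ) * δ := by positivity
          rcases lt_or_ge l q with hl | hl
          · have h1 := hδl hl.le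
            have h2 := hal (show l + 1 ≤ (q : ℤ) by omega)
            push_cast at h1 h2
            rw [hright _ (by push_cast; linarith), zero_mul]
          · have h1 := hδl (show (0 : ℤ) ≤ l by omega)
            have h2 := hal (show (q : ℤ) + 2 ≤ l by omega)
            push_cast at h1 h2
            rw [hleft _ (by push_cast; linarith), zero_mul]
    · rw [Finset.sum_pair (by omega)]
      rcases lt_trichotomy l 0 with hl | rfl | hl
      · obtain ⟨m, rfl⟩ := Int.eq_negSucc_of_lt_zero hl
        have : Int.negSucc m - 1 = Int.negSucc (m + 1) := by omega
        rw [if_neg (by omega), this, hneg, hneg]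
        simp
      · have h0 := hval 0 (by simpa using ht)
        have h1 := hgne 0 (by simpa using ht)
        have h2 := hneg 0
        rw [Nat.cast_zero] at h0
        rw [show (0 : ℤ) - 1 = Int.negSucc 0 from rfl, h2, h0]
        simp only [Nat.cast_zero, zero_mul, sub_zero] at h1
        simp [forwardCoeff, h1]
      · obtain ⟨r, rfl⟩ : ∃ r : ℕ, l = (r : ℤ) + 1 := ⟨(l - 1).toNat, by omega⟩
        rw [if_neg (by omega), add_sub_cancel_right]
        have e1 : t - ((r : ℤ) + 1 : ℤ) * (a + δ) + ((r : ℤ) + 1 : ℤ) * a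
            = t - (r + 1 : ℕ) * δ := by push_cast; ring
        have e2 : t - ((r : ℤ) + 1 : ℤ) * (a + δ) + (r : ℤ) * a
            = t - (r + 1 : ℕ) * δ - a := by push_cast; ring
        rw [e1, e2, ← Nat.cast_succ r]
        have hrr : (r : ℝ) * δ ≤ (r + 1 : ℕ) * δ := by push_cast; linarith
        -- Past the end of the recursion the new coefficient is zero and the old one is multiplied
        -- by g at a point below -a, so the relation persists.
        rcases lt_or_ge t ((r + 1 : ℕ) * δ) with hq | hq
        · rw [hlarge _ hq, hleft (t - (r + 1 : ℕ) * δ - a) (by linarith)]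
          simp
        · rw [hval _ hq, hval r (hrr.trans hq), forwardCoeff_succ_mul _ _ _ _ (hgne _ hq)]
  · have hnonneg : ∀ q : ℕ, chainInverse g a δ ε M q t = 0 := fun q =>
      indicator_of_notMem (fun h => hfw h.1) _
    have hlarge : ∀ m : ℕ, a ≤ t + m * δ → chainInverse g a δ ε M (Int.negSucc m) t = 0 :=
      fun m hm => indicator_of_notMem (fun h => absurd h.2 (not_lt.2 hm)) _
    have hval : ∀ m : ℕ, t + m * δ < a →
        chainInverse g a δ ε M (Int.negSucc m) t = backwardCoeff g a δ m t :=
      fun m hm => indicator_of_mem (show t ∈ _ ∩ _ from ⟨hfw, hm⟩) _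
    have hgne : ∀ m : ℕ, t + m * δ < a → g (t + m * δ - a) ≠ 0 := fun m hm =>
      hne _ (le_norm_of_notMem_forwardSet hδ hM hε hfw m hm)
    refine hasSum_of_hasSum_of_eq (hasSum_sum_of_ne_finset_zero (s := {l, l - 1}) fun k hk => ?_)
      (fun k => rfl) ?_
    · rw [Finset.mem_insert, Finset.mem_singleton, not_or] at hk
      cases k with
      | ofNat q => rw [Int.ofNat_eq_natCast, hnonneg, mul_zero]
      | negSucc m =>
        rcases lt_or_ge (t + m * δ) a with hm | hm
        · rw [Int.negSucc_eq] at hk ⊢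
          have hm0 : 0 ≤ (m : ℝ) * δ := by positivity
          rcases lt_or_ge l (-((m : ℤ) + 1)) with hl | hl
          · have h1 := hδl (show l ≤ 0 by omega)
            have h2 := hal (show l + 1 ≤ -((m : ℤ) + 1) by omega)
            push_cast at h1 h2
            rw [hright _ (by push_cast; linarith), zero_mul]
          · have h1 := hδl (show -(m : ℤ) ≤ l by omega)
            have h2 := hal (show -((m : ℤ) + 1) + 2 ≤ l by omega)
            push_cast at h1 h2
            rw [hleft _ (by push_cast; linarith), zero_mul]
        · rw [hlarge m hm, mul_zero]
    · rw [Finset.sum_pair (by omega)]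
      rcases lt_trichotomy l 0 with hl | rfl | hl
      · obtain ⟨r, rfl⟩ := Int.eq_negSucc_of_lt_zero hl
        have : Int.negSucc r - 1 = Int.negSucc (r + 1) := by omega
        rw [if_neg (by omega), this]
        have e1 : t - (Int.negSucc r : ℤ) * (a + δ) + (Int.negSucc r : ℤ) * a
            = t + (r + 1 : ℕ) * δ := by rw [Int.negSucc_eq]; push_cast; ring
        have e2 : t - (Int.negSucc r : ℤ) * (a + δ) + (Int.negSucc (r + 1) : ℤ) * a
            = t + (r + 1 : ℕ) * δ - a := by simp only [Int.negSucc_eq]; push_cast; ring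
        rw [e1, e2]
        have hrr : (r : ℝ) * δ ≤ (r + 1 : ℕ) * δ := by push_cast; linarith
        -- As in the forward case: past the end, the last coefficient meets g at a point that is at
        -- least a.
        rcases lt_or_ge (t + (r + 1 : ℕ) * δ) a with hq | hq
        · rw [hval _ hq, hval r (by linarith), backwardCoeff_succ_mul _ _ _ _ (hgne _ hq)]
        · rw [hlarge _ hq, hright _ hq]
          simp
      · have h0 := hval 0 (by simpa using hta)
        have h1 := hgne 0 (by simpa using hta)
        have h2 := hnonneg 0
        rw [Nat.cast_zero] at h2
        rw [show (0 : ℤ) - 1 = Int.negSucc 0 from rfl, h2, h0]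
        simp only [Nat.cast_zero, zero_mul, add_zero] at h1
        simp [backwardCoeff, ← sub_eq_add_neg, h1]
      · obtain ⟨r, rfl⟩ : ∃ r : ℕ, l = (r : ℤ) + 1 := ⟨(l - 1).toNat, by omega⟩
        rw [if_neg (by omega), add_sub_cancel_right, ← Nat.cast_succ r, hnonneg, hnonneg]
        simp

/-- Reduce p = x + l(a + δ) to its representative t in [0, a) and reindex by k = ⌊p/a⌋ - n; this is
the relation of `hasSum_mul_chainInverse` at t. -/
theorem hasSum_mul_conj_chainDual {g : ℝ → ℂ} {α a b δ ε : ℝ} {M : ℕ}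
    (hz : ∀ x, α ≤ |x| → g x = 0) (ha0 : 0 < a) (ha : α ≤ a) (hδ : 0 < δ) (hM : a < M * δ)
    (hε0 : 0 < ε)
    (hε : ∀ n < M, ∀ y : ℝ, 0 ≤ y → y + n * δ ≤ a → ε ≤ ‖g y‖ ∨ ε ≤ ‖g (y + n * δ - a)‖)
    (x : ℝ) (l : ℤ) :
    HasSum (fun n : ℤ => g (x - n * a) * conj (chainDual g a b δ ε M (x + l * (a + δ) - n * a)))
      (if l = 0 then (b : ℂ) else 0) := by
  set p := x + l * (a + δ) with hp
  obtain ⟨h1, h2⟩ := sub_floor_div_mul_mem ha0 p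
  have h := ((Equiv.subLeft ⌊p / a⌋).hasSum_iff.2
    (hasSum_mul_chainInverse hz ha hδ hM hε0 hε h1 h2 l)).mul_left (b : ℂ)
  refine hasSum_of_hasSum_of_eq h (fun n => ?_) (by split_ifs <;> simp)
  have hfl : ⌊(p - n * a) / a⌋ = ⌊p / a⌋ - n := by
    rw [sub_div, mul_div_cancel_right₀ _ ha0.ne', Int.floor_sub_intCast]
  have e1 : p - n * a - ((⌊p / a⌋ - n : ℤ) : ℝ) * a = p - ⌊p / a⌋ * a := by push_cast; ring
  have e2 : p - ⌊p / a⌋ * a - l * (a + δ) + ((⌊p / a⌋ - n : ℤ) : ℝ) * a = x - n * a := by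
    rw [hp]; push_cast; ring
  simp only [chainDual, hfl, e1, Function.comp, Equiv.subLeft_apply, e2, map_mul,
    Complex.conj_ofReal, Complex.conj_conj]
  ring

/-- Under the chain condition there is a bounded compactly supported dual window. -/
theorem ChainCondition.exists_dual {g : ℝ → ℂ} {α C a b : ℝ} {M : ℕ} (hg : IsCompactWindow g α C)
    (hc : Continuous g) (ha0 : 0 < a) (ha : α ≤ a) (hb : 0 < b) (hδ : 0 < 1 / b - a)
    (hM : a < M * (1 / b - a)) (h : ChainCondition g a (1 / b - a)) :
    ∃ (w : ℝ → ℂ) (hw : MemLp w 2 volume),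
      AreDualFrames (gaborSystem hg.memLp a b) (gaborSystem hw a b) ∧
      tsupport w ⊆ Icc (-(a * M)) (a * M) := by
  obtain ⟨ε, hε0, hε⟩ := h.exists_bound hc M
  set w := chainDual g a b (1 / b - a) ε M with hw
  have hw0 : ∀ u, u ∉ Ico (-(a * M)) (a * M) → w u = 0 := fun u hu =>
    chainDual_eq_zero ha0 hδ hM hu
  have hsupp : tsupport w ⊆ Icc (-(a * M)) (a * M) := by
    refine closure_minimal (fun u hu => ?_) isClosed_Icc
    by_contra hc
    exact hu (hw0 u fun h => hc ⟨h.1, h.2.le⟩)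
  have hcs : HasCompactSupport w := isCompact_Icc.of_isClosed_subset (isClosed_tsupport w) hsupp
  set D := b * (1 / ε * max 1 (C / ε) ^ M) with hD
  have hwD : ∀ u, ‖w u‖ ≤ D := by
    intro u
    obtain ⟨h1, h2⟩ := sub_floor_div_mul_mem ha0 u
    rw [hw, chainDual, norm_mul, RCLike.norm_conj, Complex.norm_real, Real.norm_of_nonneg hb.le]
    exact mul_le_mul_of_nonneg_left (norm_chainInverse_le hδ hM hε0 hg.norm_le hε _ h1 h2) hb.le
  have hwL : MemLp w 2 volume :=
    hcs.memLp_of_bound (measurable_chainDual hc a b _ ε M).aestronglyMeasurable D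
      (Eventually.of_forall hwD)
  -- The extra 1 is needed because the dual window may be nonzero at -aM, whereas a compact window
  -- must vanish for |x| ≥ ρ.
  set ρ := max α (a * M + 1) with hρ
  have hg' : IsCompactWindow g ρ (max C D) :=
    ⟨hg.memLp, fun x => (hg.norm_le x).trans (le_max_left _ _),
      fun x hx => hg.eq_zero x ((le_max_left _ _).trans hx)⟩
  have hw' : IsCompactWindow w ρ (max C D) := by
    refine ⟨hwL, fun x => (hwD x).trans (le_max_right _ _), fun x hx => hw0 x fun h => ?_⟩
    have h1 := abs_le.2 ⟨h.1, h.2.le⟩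
    have h2 := (le_max_right α (a * M + 1)).trans hx
    linarith
  obtain ⟨B, hB, hbes⟩ := IsCompactWindow.exists_bessel_bound ha0 hb ρ (max C D)
  refine ⟨w, hwL, areDualFrames_of_bessel_of_hasSum hB (hbes g hg') (hbes w hw')
    (hg'.hasSum_inner_mul_inner_of_duality hw' ha0 hb fun x l => ?_), hsupp⟩
  have := hasSum_mul_conj_chainDual (b := b) hg.eq_zero ha0 ha hδ hM hε0 hε x l
  rwa [add_sub_cancel] at this

end DualWindow

/-! ### The chain condition and the poles of Rₙ and Lₙ. -/

section PoleConditions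

variable {g : ℝ → ℂ} {α a b : ℝ} {κ : ℕ}

theorem one_sub_mul_mul_div (hb : 0 < b) (x : ℝ) : (1 - a * b) * (x / b) = x * (1 / b - a) := by
  field_simp

theorem ChainCondition.norm_add_norm_pos (h : ChainCondition g a (1 / b - a)) {x : ℝ}
    (hx : x ∈ Icc (-a) 0) : 0 < ‖g x‖ + ‖g (x + a)‖ := by
  rcases h 0 (x + a) (by linarith [hx.1]) (by simpa using hx.2) with h1 | h1
  · have := norm_pos_iff.2 h1
    positivity
  · simp only [Nat.cast_zero, zero_mul, add_zero, add_sub_cancel_right] at h1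
    have := norm_pos_iff.2 h1
    positivity

theorem ChainCondition.ne_zero_of_isRPole (h : ChainCondition g a (1 / b - a)) (hb : 0 < b)
    (ha : α ≤ a) {n : ℕ} {y : ℝ} (hy : IsRPole g α a b κ n y) :
    g (y + (1 - a * b) * (n / b) - a) ≠ 0 := by
  obtain ⟨-, ⟨h1, h2⟩, h3, -⟩ := hy
  rw [one_sub_mul_mul_div hb] at *
  exact (h n y (by linarith) (by linarith)).resolve_left (not_not.2 h3)

/-- An L-pole is the end of a chain read backwards: the chain starts at y - nδ + a and arrives at y
+ a after n steps. -/
theorem ChainCondition.ne_zero_of_isLPole (h : ChainCondition g a (1 / b - a)) (hb : 0 < b)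
    (ha : α ≤ a) {n : ℕ} {y : ℝ} (hy : IsLPole g α a b κ n y) :
    g (y - (1 - a * b) * (n / b) + a) ≠ 0 := by
  obtain ⟨-, ⟨h1, h2⟩, h3, -⟩ := hy
  rw [one_sub_mul_mul_div hb] at *
  refine (h n (y - n * (1 / b - a) + a) (by linarith) (by linarith)).resolve_right (not_not.2 ?_)
  rw [← h3]
  congr 1
  ring

/-- If the two points agreed, the chains would join into one of n₁ + n₂ steps from the zero y₁ to y₂
+ a, with g(y₂) = 0. -/
theorem ChainCondition.pole_ne_pole (h : ChainCondition g a (1 / b - a)) (hb : 0 < b)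
    (ha : α ≤ a) {n₁ n₂ : ℕ} {y₁ y₂ : ℝ} (hy₁ : IsRPole g α a b κ n₁ y₁)
    (hy₂ : IsLPole g α a b κ n₂ y₂) :
    y₁ + (1 - a * b) * (n₁ / b) ≠ y₂ - (1 - a * b) * (n₂ / b) + a := by
  obtain ⟨-, ⟨h1, h2⟩, h3, -⟩ := hy₁
  obtain ⟨-, ⟨h4, h5⟩, h6, -⟩ := hy₂
  rw [one_sub_mul_mul_div hb] at *
  rw [one_sub_mul_mul_div hb]
  intro heq
  have h7 : y₁ + ((n₁ + n₂ : ℕ) : ℝ) * (1 / b - a) - a = y₂ := by push_cast; linarith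
  rcases h (n₁ + n₂) y₁ (by linarith) (by linarith) with h8 | h8
  · exact h8 h3
  · rw [h7] at h8
    exact h8 h6

/-- `|R_n|` blows up at a zero of `g` as long as the numerators do not vanish there. -/
theorem tendsto_norm_Rfun_atTop (hc : Continuous g) {C : ℝ} (hC : ∀ x, ‖g x‖ ≤ C) {n : ℕ} {y : ℝ}
    (hy : g y = 0) (hne : ∀ k ∈ Finset.Ico 1 n, g (y + (1 - a * b) * (k / b) - a) ≠ 0) :
    Tendsto (fun t => ‖Rfun g a b n t‖) (𝓝[Rdomain g α a b n] y) atTop := by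
  set D := max C 1 with hD
  have hD0 : 0 < D := lt_max_of_lt_right one_pos
  set P : ℝ → ℝ := fun t => ∏ k ∈ Finset.Ico 1 n, (‖g (t + (1 - a * b) * (k / b) - a)‖ / D) with hP
  have hPc : Continuous P := by fun_prop
  have hPy : 0 < P y := Finset.prod_pos fun k hk => div_pos (norm_pos_iff.2 (hne k hk)) hD0
  have hg0 : Tendsto (fun t => ‖g t‖) (𝓝[Rdomain g α a b n] y) (𝓝[>] 0) := by
    refine tendsto_nhdsWithin_iff.2 ⟨?_, ?_⟩
    · have := (hc.norm.tendsto y).mono_left (nhdsWithin_le_nhds (s := Rdomain g α a b n))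
      rwa [hy, norm_zero] at this
    · filter_upwards [self_mem_nhdsWithin] with t ht
      exact norm_pos_iff.2 ht.2.1
  have h1 : Tendsto (fun t => ‖g t‖⁻¹ * P t) (𝓝[Rdomain g α a b n] y) atTop :=
    (tendsto_inv_nhdsGT_zero.comp hg0).atTop_mul_pos hPy
      ((hPc.tendsto y).mono_left nhdsWithin_le_nhds)
  refine tendsto_atTop_mono' _ ?_ h1
  filter_upwards [self_mem_nhdsWithin] with t ht
  rw [Rfun, norm_mul, norm_div, norm_one, one_div, norm_prod]
  refine mul_le_mul_of_nonneg_left (Finset.prod_le_prod (fun _ _ => by positivity) fun k hk => ?_)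
    (by positivity)
  rw [norm_div]
  exact div_le_div_of_nonneg_left (norm_nonneg _) (norm_pos_iff.2 (ht.2.2 k hk))
    ((hC _).trans (le_max_left _ _))

/-- Strong induction on the length n. If n = 0, y ≤ a - α or y + nδ > α, then (i) decides. Otherwise
n ≤ κ and y lies in the interval of Rₙ; the induction hypothesis for k < n says that no numerator of
Rₙ vanishes at y, so y is a pole and (ii) applies. -/
theorem chainCondition_of_poles (hc : Continuous g) {C : ℝ} (hg : IsCompactWindow g α C)
    (hb : 0 < b) (hδ : 0 < 1 / b - a)
    (hκ : IsGreatest {k : ℤ | (1 - a * b) * k ≤ b * α} (κ : ℤ))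
    (h1 : ∀ x ∈ Icc (-a) 0, 0 < ‖g x‖ + ‖g (x + a)‖)
    (h2 : ∀ (n : ℕ) (y : ℝ), IsRPole g α a b κ n y → g (y + (1 - a * b) * (n / b) - a) ≠ 0) :
    ChainCondition g a (1 / b - a) := by
  have h1' : ∀ t, 0 ≤ t → t ≤ a → g t = 0 → g (t - a) ≠ 0 := by
    intro t ht hta hgt hgta
    have := h1 (t - a) ⟨by linarith, by linarith⟩
    rw [sub_add_cancel, hgt, hgta] at this
    simp at this
  intro n y hy0 hya
  rw [or_iff_not_imp_left, not_not]
  intro hgy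
  induction n using Nat.strong_induction_on with
  | _ n ih =>
    have hn0 : 0 ≤ (n : ℝ) * (1 / b - a) := by positivity
    rcases Nat.eq_zero_or_pos n with rfl | hn
    · simpa using h1' y hy0 (by linarith) hgy
    · rcases le_or_gt y (a - α) with hle | hgt
      · exact absurd (hg.eq_zero _ (le_abs.2 (Or.inr (by linarith)))) (h1' y hy0 (by linarith) hgy)
      · rcases lt_or_ge α (y + n * (1 / b - a)) with hlt | hge
        · exact h1' _ (by linarith) hya (hg.eq_zero _ (le_abs.2 (Or.inl hlt.le)))
        · have hnκ : n ≤ κ := by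
            have h3 : (1 - a * b) * ((n : ℤ) : ℝ) ≤ b * α := by
              have h4 : (1 - a * b) * ((n : ℤ) : ℝ) = b * (n * (1 / b - a)) := by
                push_cast; field_simp
              rw [h4]
              exact mul_le_mul_of_nonneg_left (by linarith) hb.le
            exact_mod_cast hκ.2 h3
          have h5 := h2 n y ⟨Finset.mem_Icc.2 ⟨hn, hnκ⟩, ⟨hgt, ?_⟩, hgy,
            tendsto_norm_Rfun_atTop hc hg.norm_le hgy fun k hk => ?_⟩
          · rwa [one_sub_mul_mul_div hb] at h5
          · rw [one_sub_mul_mul_div hb]; linarith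
          · rw [one_sub_mul_mul_div hb]
            have hkn := (Finset.mem_Ico.1 hk).2
            refine ih k hkn ?_
            have : (k : ℝ) * (1 / b - a) ≤ n * (1 / b - a) := by
              have : (k : ℝ) ≤ n := by exact_mod_cast hkn.le
              gcongr
            linarith

end PoleConditions

/-! ### The characterization and the dual window. -/

theorem theorem2p1 (α a b : ℝ) (M κ : ℕ) (g : ℝ → ℂ)
    (hα : 0 < α) (hg : WindowClass α g)
    (ha : α ≤ a) (ha' : a < 2 * α) (hb : 0 < b) (hM : 2 ≤ M)
    (hab : ((M : ℝ) - 1) / M ≤ a * b) (hab' : a * b < (M : ℝ) / (M + 1))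
    (hκ : IsGreatest {k : ℤ | (1 - a * b) * k ≤ b * α} (κ : ℤ)) :
    (IsFrame (gaborSystem hg.memLp a b) ↔
      (∀ x ∈ Icc (-a) 0, 0 < ‖g x‖ + ‖g (x + a)‖) ∧
      (∀ (n : ℕ) (y : ℝ), IsRPole g α a b κ n y →
        g (y + (1 - a * b) * (n / b) - a) ≠ 0) ∧
      (∀ (n : ℕ) (y : ℝ), IsLPole g α a b κ n y →
        g (y - (1 - a * b) * (n / b) + a) ≠ 0) ∧
      (∀ (n₁ n₂ : ℕ) (y₁ y₂ : ℝ), IsRPole g α a b κ n₁ y₁ → IsLPole g α a b κ n₂ y₂ →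
        y₁ + (1 - a * b) * (n₁ / b) ≠ y₂ - (1 - a * b) * (n₂ / b) + a)) ∧
    (IsFrame (gaborSystem hg.memLp a b) →
      ∃ (h : ℝ → ℂ) (hh : MemLp h 2 volume),
        AreDualFrames (gaborSystem hg.memLp a b) (gaborSystem hh a b) ∧
        tsupport h ⊆ Icc (-(a * M)) (a * M)) := by
  have ha0 : 0 < a := hα.trans_le ha
  -- Multiplied by b this is ab < M(1 - ab), a rearrangement of ab < M/(M+1).
  have hMa : a < M * (1 / b - a) := by
    rw [lt_div_iff₀ (by positivity)] at hab'
    have h1 : b * (M * (1 / b - a)) = M - M * (a * b) := by field_simp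
    refine lt_of_mul_lt_mul_left ?_ hb.le
    rw [h1]
    linarith
  have hδ : 0 < 1 / b - a := by
    by_contra hcon
    nlinarith [mul_nonneg (Nat.cast_nonneg (α := ℝ) M) (sub_nonneg.2 (not_lt.1 hcon))]
  obtain ⟨C, hC⟩ := hg.continuous.bounded_above_of_compact_support (by
    rw [HasCompactSupport, hg.tsupport_eq]; exact isCompact_Icc)
  have hw : IsCompactWindow g α C := ⟨hg.memLp, hC, fun x => hg.eq_zero⟩
  have hnec : IsFrame (gaborSystem hg.memLp a b) → ChainCondition g a (1 / b - a) :=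
    IsFrame.chainCondition hw hg.continuous hα ha hb hδ
  have hdual := fun h : ChainCondition g a (1 / b - a) =>
    h.exists_dual hw hg.continuous ha0 ha hb hδ hMa
  refine ⟨⟨fun hF => ?_, fun ⟨h1, h2, _, _⟩ => ?_⟩, fun hF => hdual (hnec hF)⟩
  · have h := hnec hF
    exact ⟨fun x hx => h.norm_add_norm_pos hx, fun n y => h.ne_zero_of_isRPole hb ha,
      fun n y => h.ne_zero_of_isLPole hb ha, fun n₁ n₂ y₁ y₂ => h.pole_ne_pole hb ha⟩
  · obtain ⟨_, _, hd, _⟩ :=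
      hdual (chainCondition_of_poles hg.continuous hw hb hδ hκ h1 h2)
    exact hd.1
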